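/- Let $K$ be an algebraically closed field of characteristic $\neq 2$, $m\ge 0$, $V=K^m$, $w\in\mathbb Z$, $h:\mathbb Z\to\mathbb N$. **Notation.** Let $\check L$ be the $K$-scheme whose $A$-points are the finite decreasing filtrations $F^\bullet$ of $A^m$ with $F^i/F^{i+1}$ locally free of rank $h^i$ for all $i$. For a filtration $F^\bullet$ of $V$ (or of $A^m$), give $V^*$ the filtration $F^iV^*=\{\varphi:\varphi(F^{1-i})=0\}$ and $V^{a,b}=V^{\otimes a}\otimes (V^*)^{\otimes b}$ the tensor product filtration. Regard $F^\bullet$ as a filtration of weight $w$, so that $V^{a,b}$ has weight $w(a-b)$; let $F^{\mathrm{mid}}V^{a,b}$ be $F^{w(a-b)/2}V^{a,b}$ if $w(a-b)$ is even and $0$ if it is odd, and put $F^{\mathrm{mid}}=\bigoplus_{a,b\ge 0}F^{\mathrm{mid}}V^{a,b}$. **Data.** Let $Q$ be a non-degenerate symmetric or alternating bilinear form on $V$, viewed as an element of $V^{0,2}$. Let $F^\bullet\in\check L(K)$, let $F_c^\bullet$ be a filtration of $V$ opposed to $F^\bullet$ (i.e. $F^p\oplus F_c^{w-p+1}=V$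 for all $p$), and let $U\subset\bigoplus_{a,b\ge0}V^{a,b}$ be a $K$-subspace with $Q\in U\subset F^{\mathrm{mid}}\cap F_c^{\mathrm{mid}}$. Put $H^{p,w-p}=F^p\cap F_c^{w-p}$, so $V=\bigoplus_pH^{p,w-p}$. Let $\mathbf G\subset \mathrm{GL}_m$ be the group scheme of elements fixing every element of $U$, $\mathbf G^\circ$ its identity component, $\mathfrak g$ its Lie algebra. Let $Y\subset\check L$ be the subscheme of the flags $F'^\bullet$ with $U\subset F'^{\mathrm{mid}}$ (functorially in $K$-algebras). Let $\beta:\mathbb G_m\to\mathrm{GL}_m$ be the cocharacter acting on $H^{p,w-p}$ as $z^{p-w/2}$ if $w$ is even and as $z^p$ if $w$ is odd. For $i\in\mathbb Z$ put $$\mathrm{End}(V)^i=\sum_p\mathrm{Hom}(H^{p,w-p},H^{p-i,w-p+i}),\qquad \mathfrak g^i=\mathfrak g\cap\mathrm{End}(V)^i .$$ **Proposition.** 1. $Y$ has exactly one irreducible component $O(F^\bullet,U)$ containing $F^\bullet$; its set of $K$-points is the Zariski closure in $\check L(K)$ of the orbit $\mathbf G^\circ(K)\cdot F^\bullet$, and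 it contains a neighbourhood of $F^\bullet$ in $Y(K)$. 2. $\mathrm{End}(V)=\bigoplus_i\mathrm{End}(V)^i$, and $\mathrm{End}(V)^i$ is the subspace on which $\mathrm{Ad}\,\beta(z)$ acts as $z^{-i}$. 3. If $w$ is even, $\beta$ factors through $\mathbf G$. If $w$ is odd, the cocharacter $z\mapsto z^{-w}\beta(z)^2$, which acts on $H^{p,w-p}$ as $z^{2p-w}$, factors through $\mathbf G$. For every $w$, $\beta$ normalizes $\mathbf G$, and $\mathfrak g=\bigoplus_i\mathfrak g^i$. 4. Let $T_{F^\bullet}O(F^\bullet,U)$ be the tangent space at $F^\bullet$ for the scheme structure inherited from $Y$ (which agrees with $O(F^\bullet,U)$ near $F^\bullet$), that is, the space of $K[\varepsilon]$-points of $Y$ over $F^\bullet$, embedded in $\prod_p\mathrm{Hom}(F^p,V/F^p)$. Then the natural map $\bigoplus_{i>0}\mathfrak g^i\to T_{F^\bullet}O(F^\bullet,U)$, induced by $\mathrm{End}(V)\to\prod_p\mathrm{Hom}(F^p,V/F^p)$, is an isomorphism. -/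

import Mathlib

open scoped MatrixGroups

universe u

noncomputable section

namespace TensorFlag

/-! ### Mixed tensors on `A ^ m` -/

/-- Mixed tensors of type `(a, b)` on `A ^ m`, i.e. `(A ^ m)^{⊗ a} ⊗ ((A ^ m)^*)^{⊗ b}`, given by
their coordinates with respect to the basis `e_{i 1} ⊗ ⋯ ⊗ e_{i a} ⊗ e^{j 1} ⊗ ⋯ ⊗ e^{j b}`
induced by the standard basis. -/
abbrev Tensor (m : ℕ) (A : Type u) (a b : ℕ) : Type u :=
  (Fin a → Fin m) → (Fin b → Fin m) → A

/-- The direct sum of the tensor spaces of all types `(a, b)`. -/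
abbrev TensorSum (m : ℕ) (A : Type u) [CommRing A] : Type u :=
  DirectSum (ℕ × ℕ) (fun ab => Tensor m A ab.1 ab.2)

section Tensors

variable {m : ℕ} {A B : Type u} [CommRing A] [CommRing B] {a b : ℕ}

/-- The tensor `x 1 ⊗ ⋯ ⊗ x a ⊗ φ 1 ⊗ ⋯ ⊗ φ b`. A linear form `φ` on `A ^ m` is given by its
coordinates, so that `φ(x) = φ ⬝ᵥ x`. -/
def pureTensor (x : Fin a → Fin m → A) (φ : Fin b → Fin m → A) : Tensor m A a b :=
  fun i j => (∏ s, x s (i s)) * ∏ t, φ t (j t)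

/-- Extension of scalars of tensors along a ring homomorphism. -/
def Tensor.map (f : A →+* B) (t : Tensor m A a b) : Tensor m B a b :=
  fun i j => f (t i j)

/-- The natural action of `GL_m(A)` on tensors, by `g` on each factor `A ^ m` and by
`φ ↦ φ ∘ g⁻¹` on each factor `(A ^ m)^*`. -/
def Tensor.act (g : GL (Fin m) A) (t : Tensor m A a b) : Tensor m A a b :=
  fun i j => ∑ i' : Fin a → Fin m, ∑ j' : Fin b → Fin m,
    (∏ s, (g : Matrix (Fin m) (Fin m) A) (i s) (i' s)) *
      (∏ s, ((g⁻¹ : GL (Fin m) A) : Matrix (Fin m) (Fin m) A) (j' s) (j s)) * t i' j'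

theorem prod_one_apply {n : ℕ} (i j : Fin n → Fin m) :
    (∏ s, (1 : Matrix (Fin m) (Fin m) A) (i s) (j s)) = if i = j then 1 else 0 := by
  by_cases h : i = j
  · subst h
    simp [Matrix.one_apply_eq]
  · rw [if_neg h]
    obtain ⟨s, hs⟩ := Function.ne_iff.1 h
    exact Finset.prod_eq_zero (Finset.mem_univ s) (Matrix.one_apply_ne hs)

theorem prod_mul_apply {n : ℕ} (M N : Matrix (Fin m) (Fin m) A) (i j : Fin n → Fin m) :
    (∏ s, (M * N) (i s) (j s)) =
      ∑ k : Fin n → Fin m, (∏ s, M (i s) (k s)) * ∏ s, N (k s) (j s) := by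
  simp only [Matrix.mul_apply, Finset.prod_univ_sum, Fintype.piFinset_univ,
    Finset.prod_mul_distrib]

theorem Tensor.act_one (t : Tensor m A a b) : Tensor.act 1 t = t := by
  funext i j
  simp [Tensor.act, prod_one_apply]

theorem Tensor.act_mul (g h : GL (Fin m) A) (t : Tensor m A a b) :
    Tensor.act (g * h) t = Tensor.act g (Tensor.act h t) := by
  have swap : ∀ f : (Fin a → Fin m) → (Fin b → Fin m) → (Fin a → Fin m) → (Fin b → Fin m) → A,
      ∑ i', ∑ j', ∑ k, ∑ l, f i' j' k l = ∑ k, ∑ l, ∑ i', ∑ j', f i' j' k l := by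
    intro f
    calc ∑ i', ∑ j', ∑ k, ∑ l, f i' j' k l
        = ∑ i', ∑ k, ∑ j', ∑ l, f i' j' k l :=
          Finset.sum_congr rfl fun _ _ => Finset.sum_comm
      _ = ∑ k, ∑ i', ∑ j', ∑ l, f i' j' k l := Finset.sum_comm
      _ = ∑ k, ∑ i', ∑ l, ∑ j', f i' j' k l :=
          Finset.sum_congr rfl fun _ _ => Finset.sum_congr rfl fun _ _ => Finset.sum_comm
      _ = ∑ k, ∑ l, ∑ i', ∑ j', f i' j' k l :=
          Finset.sum_congr rfl fun _ _ => Finset.sum_comm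
  funext i j
  simp only [Tensor.act, mul_inv_rev, Units.val_mul, prod_mul_apply]
  calc _ = ∑ i' : Fin a → Fin m, ∑ j' : Fin b → Fin m, ∑ k : Fin a → Fin m, ∑ l : Fin b → Fin m,
        ((∏ s, g.1 (i s) (k s)) * ∏ s, h.1 (k s) (i' s)) *
          ((∏ s, h⁻¹.1 (j' s) (l s)) * ∏ s, g⁻¹.1 (l s) (j s)) * t i' j' := by
        refine Finset.sum_congr rfl fun i' _ => Finset.sum_congr rfl fun j' _ => ?_
        rw [Finset.sum_mul_sum, Finset.sum_mul]
        exact Finset.sum_congr rfl fun k _ => Finset.sum_mul _ _ _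
    _ = _ := by
        rw [swap]
        refine Finset.sum_congr rfl fun k _ => Finset.sum_congr rfl fun l _ => ?_
        simp only [Finset.mul_sum]
        refine Finset.sum_congr rfl fun i' _ => Finset.sum_congr rfl fun j' _ => ?_
        ring

theorem Tensor.map_act (f : A →+* B) (g : GL (Fin m) A) (t : Tensor m A a b) :
    Tensor.map f (Tensor.act g t) =
      Tensor.act (Matrix.GeneralLinearGroup.map f g) (Tensor.map f t) := by
  funext i j
  simp only [Tensor.map, Tensor.act, map_sum, map_mul, map_prod, ← map_inv]
  rfl

end Tensors

/-! ### Filtrations of tensors induced by a filtration of `A ^ m` -/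

section Filtrations

variable {m : ℕ} {A : Type u} [CommRing A]

/-- The filtration on `(A ^ m)^*` induced by the filtration `F` of `A ^ m`: its `i`-th step
consists of the linear forms that vanish on `F (1 - i)`. -/
def dualFiltration (F : ℤ → Submodule A (Fin m → A)) (i : ℤ) : Submodule A (Fin m → A) where
  carrier := {φ | ∀ x ∈ F (1 - i), φ ⬝ᵥ x = 0}
  add_mem' hφ hψ x hx := by rw [add_dotProduct, hφ x hx, hψ x hx, add_zero]
  zero_mem' x _ := zero_dotProduct x
  smul_mem' c φ hφ x hx := by rw [smul_dotProduct, hφ x hx, smul_zero]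

/-- The filtration on the tensors of type `(a, b)` induced by the filtration `F` of `A ^ m`
(the tensor product of the filtrations on the factors). -/
def tensorFiltration (F : ℤ → Submodule A (Fin m → A)) (a b : ℕ) (k : ℤ) :
    Submodule A (Tensor m A a b) :=
  Submodule.span A {t | ∃ (p : Fin a → ℤ) (q : Fin b → ℤ)
    (x : Fin a → Fin m → A) (φ : Fin b → Fin m → A),
    k ≤ ∑ s, p s + ∑ s, q s ∧ (∀ s, x s ∈ F (p s)) ∧
    (∀ s, φ s ∈ dualFiltration F (q s)) ∧ t = pureTensor x φ}

/-- The middle step `F^mid` on the tensors of type `(a, b)`, where `F` is regarded as a filtration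
of weight `w`. The induced filtration on tensors has weight `w * (a - b)`; its middle step is the
one at half the weight if the weight is even, and zero if the weight is odd. -/
def midTensors (w : ℤ) (F : ℤ → Submodule A (Fin m → A)) (a b : ℕ) :
    Submodule A (Tensor m A a b) :=
  open scoped Classical in
  if Even (w * ((a : ℤ) - b)) then tensorFiltration F a b (w * ((a : ℤ) - b) / 2) else ⊥

/-- Two filtrations of weight `w` are opposed if `F p ⊕ F' (w - p + 1) = A ^ m` for all `p`. -/
def Opposed (w : ℤ) (F F' : ℤ → Submodule A (Fin m → A)) : Prop :=
  ∀ p : ℤ, IsCompl (F p) (F' (w - p + 1))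

/-- `H^{p, w - p} = F^p ∩ F'^{w - p}`. -/
def hodgePiece (w : ℤ) (F F' : ℤ → Submodule A (Fin m → A)) (p : ℤ) :
    Submodule A (Fin m → A) :=
  F p ⊓ F' (w - p)

/-- A bilinear form on `A ^ m`, as an element of the direct sum of all tensor spaces, placed in
type `(0, 2)`. -/
def formTensor (Q : LinearMap.BilinForm A (Fin m → A)) : TensorSum m A :=
  DirectSum.of (fun ab : ℕ × ℕ => Tensor m A ab.1 ab.2) (0, 2)
    (fun _ j => Q (Pi.single (j 0) 1) (Pi.single (j 1) 1))

end Filtrations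

/-! ### The flag variety -/

/-- The `A`-points of the scheme of flags of type `h`: finite decreasing filtrations of `A ^ m`
whose `i`-th graded piece is locally free of rank `h i`, for all `i`. -/
@[ext] structure Flag (m : ℕ) (h : ℤ → ℕ) (A : Type u) [CommRing A] where
  /-- The steps of the filtration. -/
  fil : ℤ → Submodule A (Fin m → A)
  antitone_fil : Antitone fil
  exhaustive : ∃ i, fil i = ⊤
  separated : ∃ i, fil i = ⊥
  finite_gr : ∀ i, Module.Finite A (fil i ⧸ (fil (i + 1)).submoduleOf (fil i))
  projective_gr : ∀ i, Module.Projective A (fil i ⧸ (fil (i + 1)).submoduleOf (fil i))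
  rank_gr : ∀ i 𝔭, Module.rankAtStalk (R := A) (fil i ⧸ (fil (i + 1)).submoduleOf (fil i)) 𝔭 = h i

section Flags

variable {m : ℕ} {h : ℤ → ℕ} {A : Type u} [CommRing A]

/-- The graded pieces of the image of a filtration under an automorphism. -/
def grMapEquiv {V : Type u} [AddCommGroup V] [Module A V] (e : V ≃ₗ[A] V) (P P' : Submodule A V) :
    (P ⧸ P'.submoduleOf P) ≃ₗ[A]
      (P.map (e : V →ₗ[A] V) ⧸
        (P'.map (e : V →ₗ[A] V)).submoduleOf (P.map (e : V →ₗ[A] V))) :=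
  Submodule.Quotient.equiv _ _ (e.submoduleMap P) (by
    ext ⟨y, hy⟩
    obtain ⟨x, hx, rfl⟩ := hy
    simp only [Submodule.mem_map, Submodule.submoduleOf, Submodule.mem_comap]
    constructor
    · rintro ⟨⟨z, hz⟩, hz', hzx⟩
      exact ⟨z, hz', congrArg Subtype.val hzx⟩
    · rintro ⟨z, hz, hzx⟩
      obtain rfl : z = x := e.injective hzx
      exact ⟨⟨z, hx⟩, hz, rfl⟩)

/-- The automorphism of `A ^ m` given by an element of `GL_m(A)`. -/
def glEquiv (g : GL (Fin m) A) : (Fin m → A) ≃ₗ[A] (Fin m → A) :=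
  LinearMap.GeneralLinearGroup.generalLinearEquiv A (Fin m → A)
    (Matrix.GeneralLinearGroup.toLin g)

/-- The action of `GL_m(A)` on flags in `A ^ m`. -/
def Flag.translate (g : GL (Fin m) A) (F : Flag m h A) : Flag m h A where
  fil i := (F.fil i).map (glEquiv g : (Fin m → A) →ₗ[A] (Fin m → A))
  antitone_fil _ _ hij := Submodule.map_mono (F.antitone_fil hij)
  exhaustive := by
    obtain ⟨i, hi⟩ := F.exhaustive
    refine ⟨i, ?_⟩
    rw [hi, Submodule.map_top]
    exact LinearEquiv.range _
  separated := by
    obtain ⟨i, hi⟩ := F.separated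
    exact ⟨i, by rw [hi, Submodule.map_bot]⟩
  finite_gr i :=
    haveI := F.finite_gr i
    Module.Finite.equiv (grMapEquiv (glEquiv g) (F.fil i) (F.fil (i + 1)))
  projective_gr i :=
    haveI := F.projective_gr i
    Module.Projective.of_equiv (grMapEquiv (glEquiv g) (F.fil i) (F.fil (i + 1)))
  rank_gr i 𝔭 := by
    rw [← Module.rankAtStalk_eq_of_equiv (grMapEquiv (glEquiv g) (F.fil i) (F.fil (i + 1)))]
    exact F.rank_gr i 𝔭

theorem Flag.mem_translate (g : GL (Fin m) A) (F : Flag m h A) (i : ℤ) (x : Fin m → A) :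
    x ∈ (F.translate g).fil i ↔
      ∃ y ∈ F.fil i, (g : Matrix (Fin m) (Fin m) A).mulVec y = x :=
  Iff.rfl

end Flags

/-! ### Zariski topologies on rational points -/

section Zariski

variable {m : ℕ} {h : ℤ → ℕ} {K : Type u} [Field K]

/-- The Zariski topology on `GL_m(K)`, induced from the affine space of matrices. -/
@[reducible] def zariskiGL (m : ℕ) (K : Type u) [Field K] : TopologicalSpace (GL (Fin m) K) :=
  TopologicalSpace.induced
    (fun g => MvPolynomial.pointToPoint (k := K)
      (fun ij : Fin m × Fin m => (g : Matrix (Fin m) (Fin m) K) ij.1 ij.2))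
    inferInstance

/-- The Zariski topology on the set of `K`-points of the flag variety, as a homogeneous space
of `GL_m`: a set is closed if and only if its preimages under the orbit maps `g ↦ g F` from
`GL_m(K)` are Zariski closed. -/
instance : TopologicalSpace (Flag m h K) :=
  ⨆ F : Flag m h K, TopologicalSpace.coinduced (fun g => F.translate g) (zariskiGL m K)

end Zariski

/-! ### The loci attached to a space of tensors -/

section Loci

variable {m : ℕ} {h : ℤ → ℕ} {K : Type u} [Field K]

/-- The functor of points of the group scheme `G` of elements of `GL_m` that fix every element
of `U`. -/
def stabilizer (U : Submodule K (TensorSum m K)) (A : Type u) [CommRing A] [Algebra K A] :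
    Subgroup (GL (Fin m) A) where
  carrier := {g | ∀ u ∈ U, ∀ ab, Tensor.act g (Tensor.map (algebraMap K A) (u ab)) =
    Tensor.map (algebraMap K A) (u ab)}
  one_mem' _ _ _ := Tensor.act_one _
  mul_mem' hg hg' u hu ab := by rw [Tensor.act_mul, hg' u hu ab, hg u hu ab]
  inv_mem' {g} hg u hu ab := by
    conv_lhs => rw [← hg u hu ab]
    rw [← Tensor.act_mul, inv_mul_cancel, Tensor.act_one]

/-- The functor of points of the subscheme of the flag variety of those flags `F'` (regarded as
filtrations of weight `w`) for which `U` is contained in `F'^mid`. -/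
def flagLocus (w : ℤ) (h : ℤ → ℕ) (U : Submodule K (TensorSum m K)) (A : Type u) [CommRing A]
    [Algebra K A] : Set (Flag m h A) :=
  {F' | ∀ u ∈ U, ∀ ab, Tensor.map (algebraMap K A) (u ab) ∈ midTensors w F'.fil ab.1 ab.2}

/-- `Z` is an irreducible component of the variety of flags `F'` with `U ⊆ F'^mid`. -/
def IsFlagLocusComponent (w : ℤ) (U : Submodule K (TensorSum m K)) (Z : Set (Flag m h K)) : Prop :=
  Maximal (fun s => IsIrreducible s ∧ s ⊆ flagLocus w h U K) Z

/-- The `K`-points of the identity component of `G`. -/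
def identityComponent (U : Submodule K (TensorSum m K)) : Set (GL (Fin m) K) :=
  @connectedComponentIn _ (zariskiGL m K) (stabilizer U K : Set (GL (Fin m) K)) 1

/-- The orbit of `F` under the identity component of `G`. -/
def flagOrbit (U : Submodule K (TensorSum m K)) (F : Flag m h K) : Set (Flag m h K) :=
  (fun g => F.translate g) '' identityComponent U

end Loci

/-! ### Lie algebra and tangent space, via dual numbers -/

section Infinitesimal

open DualNumber

variable {m : ℕ} {h : ℤ → ℕ} {K : Type u} [Field K]

/-- The matrix `ε ξ` over the dual numbers. -/
def epsMatrix (ξ : Matrix (Fin m) (Fin m) K) : Matrix (Fin m) (Fin m) K[ε] :=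
  ξ.map (fun c => (TrivSqZeroExt.inr c : K[ε]))

theorem epsMatrix_mul (ξ η : Matrix (Fin m) (Fin m) K) : epsMatrix ξ * epsMatrix η = 0 := by
  ext1 i j
  simp [epsMatrix, Matrix.mul_apply]

theorem epsMatrix_add (ξ η : Matrix (Fin m) (Fin m) K) :
    epsMatrix (ξ + η) = epsMatrix ξ + epsMatrix η := by
  ext1 i j
  exact TrivSqZeroExt.inr_add K (ξ i j) (η i j)

theorem epsMatrix_neg (ξ : Matrix (Fin m) (Fin m) K) : epsMatrix (-ξ) = -epsMatrix ξ := by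
  ext1 i j
  simp [epsMatrix]

theorem epsMatrix_zero : epsMatrix (0 : Matrix (Fin m) (Fin m) K) = 0 := by
  ext1 i j
  simp [epsMatrix]

theorem one_add_eps_mul (ξ η : Matrix (Fin m) (Fin m) K) :
    (1 + epsMatrix ξ) * (1 + epsMatrix η) = 1 + epsMatrix (ξ + η) := by
  rw [add_mul, mul_add, mul_add, epsMatrix_mul, epsMatrix_add]
  simp only [one_mul, mul_one, add_zero]
  abel

/-- The element `1 + ε ξ` of `GL_m(K[ε])`. -/
def oneAddEps (ξ : Matrix (Fin m) (Fin m) K) : GL (Fin m) K[ε] where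
  val := 1 + epsMatrix ξ
  inv := 1 + epsMatrix (-ξ)
  val_inv := by rw [one_add_eps_mul, add_neg_cancel, epsMatrix_zero, add_zero]
  inv_val := by rw [one_add_eps_mul, neg_add_cancel, epsMatrix_zero, add_zero]

theorem oneAddEps_add (ξ η : Matrix (Fin m) (Fin m) K) :
    oneAddEps (ξ + η) = oneAddEps ξ * oneAddEps η :=
  Units.ext (one_add_eps_mul ξ η).symm

theorem oneAddEps_zero : oneAddEps (0 : Matrix (Fin m) (Fin m) K) = 1 :=
  Units.ext (by simp [oneAddEps, epsMatrix_zero])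

/-- The endomorphism `ε ↦ c ε` of the `K`-algebra of dual numbers. -/
def scaleEps (c : K) : K[ε] →ₐ[K] K[ε] :=
  TrivSqZeroExt.map (LinearMap.lsmul K K c)

theorem map_scaleEps (c : K) (ξ : Matrix (Fin m) (Fin m) K) :
    Matrix.GeneralLinearGroup.map (scaleEps c : K[ε] →+* K[ε]) (oneAddEps ξ) =
      oneAddEps (c • ξ) := by
  refine Units.ext ?_
  ext1 i j
  by_cases hij : i = j
  · subst hij
    refine TrivSqZeroExt.ext ?_ ?_ <;> simp [oneAddEps, epsMatrix, scaleEps, mul_comm]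
  · refine TrivSqZeroExt.ext ?_ ?_ <;>
      simp [oneAddEps, epsMatrix, scaleEps, Matrix.one_apply_ne hij, mul_comm]

/-- The Lie algebra of `G`: the matrices `ξ` for which `1 + ε ξ` is a `K[ε]`-point of `G`. -/
def lieAlgebra (U : Submodule K (TensorSum m K)) : Submodule K (Matrix (Fin m) (Fin m) K) where
  carrier := {ξ | oneAddEps ξ ∈ stabilizer U K[ε]}
  zero_mem' := by
    simp only [Set.mem_ofPred_eq, oneAddEps_zero]
    exact one_mem _
  add_mem' {ξ η} hξ hη := by
    simp only [Set.mem_ofPred_eq, oneAddEps_add] at *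
    exact mul_mem hξ hη
  smul_mem' c ξ hξ := by
    intro u hu ab
    have hc : ((scaleEps c : K[ε] →+* K[ε])).comp (algebraMap K K[ε]) = algebraMap K K[ε] :=
      (scaleEps c).comp_algebraMap
    have hbase : Tensor.map (scaleEps c : K[ε] →+* K[ε]) (Tensor.map (algebraMap K K[ε]) (u ab)) =
        Tensor.map (algebraMap K K[ε]) (u ab) := by
      funext i j
      exact congrArg (fun f : K →+* K[ε] => f (u ab i j)) hc
    have := congrArg (Tensor.map (scaleEps c : K[ε] →+* K[ε])) (hξ u hu ab)
    rwa [Tensor.map_act, map_scaleEps, hbase] at this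

/-- The first order deformation of the subspace `W` of `K ^ m` in the direction of
`φ : W → K ^ m / W`, namely the submodule of all `x + ε y` in `K[ε] ^ m` with `x ∈ W` and
`y` in the class `φ x`. -/
def deformation (W : Submodule K (Fin m → K)) (φ : W →ₗ[K] (Fin m → K) ⧸ W) :
    Submodule K[ε] (Fin m → K[ε]) where
  carrier := {v | ∃ x : W, (∀ i, (v i).fst = (x : Fin m → K) i) ∧
    Submodule.Quotient.mk (fun i => (v i).snd) = φ x}
  zero_mem' := ⟨0, fun i => by simp, by rw [map_zero]; rfl⟩
  add_mem' := by
    rintro v v' ⟨x, hx, hφ⟩ ⟨x', hx', hφ'⟩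
    refine ⟨x + x', fun i => by simp [hx, hx'], ?_⟩
    rw [map_add, ← hφ, ← hφ']
    rfl
  smul_mem' := by
    rintro c v ⟨x, hx, hφ⟩
    refine ⟨c.fst • x, fun i => by simp [hx], ?_⟩
    have hmem : c.snd • (x : Fin m → K) ∈ W := W.smul_mem _ x.2
    rw [map_smul, ← hφ, ← Submodule.Quotient.mk_smul, Submodule.Quotient.eq]
    convert hmem using 1
    funext i
    simp [hx]

/-- The tangent space at `F` of the scheme of flags `F'` with `U ⊆ F'^mid`: the `K[ε]`-points of
this scheme that reduce to `F`, inside the tangent space `∏ p, Hom(F^p, K ^ m / F^p)` at `F` of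
the product of the Grassmannians. -/
def flagLocusTangent (w : ℤ) (U : Submodule K (TensorSum m K)) (F : Flag m h K) :
    Set (∀ p : ℤ, F.fil p →ₗ[K] (Fin m → K) ⧸ F.fil p) :=
  {φ | ∃ F' ∈ flagLocus w h U K[ε], ∀ p, F'.fil p = deformation (F.fil p) (φ p)}

/-- The natural map `End(K ^ m) → ∏ p, Hom(F^p, K ^ m / F^p)`, which is the derivative at the
identity of the orbit map `g ↦ g F`. -/
def tangentMap (F : Flag m h K) :
    Matrix (Fin m) (Fin m) K →ₗ[K] ∀ p : ℤ, F.fil p →ₗ[K] (Fin m → K) ⧸ F.fil p :=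
  LinearMap.pi fun p =>
    { toFun := fun ξ => (F.fil p).mkQ ∘ₗ Matrix.mulVecLin ξ ∘ₗ (F.fil p).subtype
      map_add' := fun ξ η => by
        ext x
        simp
      map_smul' := fun c ξ => by
        ext x
        simp }

end Infinitesimal

/-! ### Cocharacters and gradings -/

/-- A cocharacter of `GL_m` over `K`: a homomorphism of group functors from `𝔾_m` to `GL_m` on
commutative `K`-algebras. -/
structure Cocharacter (K : Type u) [Field K] (m : ℕ) where
  /-- The homomorphism on `A`-points. -/
  hom : ∀ (A : Type u) [CommRing A] [Algebra K A], Aˣ →* GL (Fin m) A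
  natural : ∀ (A B : Type u) [CommRing A] [Algebra K A] [CommRing B] [Algebra K B] (f : A →ₐ[K] B)
    (z : Aˣ), hom B (Units.map (f : A →* B) z) =
      Matrix.GeneralLinearGroup.map (f : A →+* B) (hom A z)

section Gradings

variable {m : ℕ} {K : Type u} [Field K]

/-- `β` acts as `z ^ (e p)` on the subspace `H p`, for all `p`. -/
def Cocharacter.ActsBy (β : Cocharacter K m) (H : ℤ → Submodule K (Fin m → K)) (e : ℤ → ℤ) : Prop :=
  ∀ (A : Type u) [CommRing A] [Algebra K A] (z : Aˣ) (p : ℤ), ∀ x ∈ H p,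
    (β.hom A z : Matrix (Fin m) (Fin m) A).mulVec (fun i => algebraMap K A (x i)) =
      ((z ^ e p : Aˣ) : A) • (fun i => algebraMap K A (x i))

/-- `β` factors through the stabilizer `G` of `U`. -/
def Cocharacter.FactorsThrough (β : Cocharacter K m) (U : Submodule K (TensorSum m K)) : Prop :=
  ∀ (A : Type u) [CommRing A] [Algebra K A] (z : Aˣ), β.hom A z ∈ stabilizer U A

/-- `β` normalizes the stabilizer `G` of `U`. -/
def Cocharacter.Normalizes (β : Cocharacter K m) (U : Submodule K (TensorSum m K)) : Prop :=
  ∀ (A : Type u) [CommRing A] [Algebra K A] (z : Aˣ),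
    ∀ g ∈ stabilizer U A, β.hom A z * g * (β.hom A z)⁻¹ ∈ stabilizer U A

/-- The endomorphisms on which `Ad β` acts as `z ^ n`. -/
def Cocharacter.adWeightSet (β : Cocharacter K m) (n : ℤ) : Set (Matrix (Fin m) (Fin m) K) :=
  {ξ | ∀ (A : Type u) [CommRing A] [Algebra K A] (z : Aˣ),
    (β.hom A z : Matrix (Fin m) (Fin m) A) * ξ.map (algebraMap K A) *
      ((β.hom A z)⁻¹ : GL (Fin m) A) = ((z ^ n : Aˣ) : A) • ξ.map (algebraMap K A)}

/-- `∑ p, Hom(H p, H (p - i))` for a direct sum decomposition `K ^ m = ⨁ p, H p`: the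
endomorphisms that map `H p` to `H (p - i)` for all `p`. -/
def endGraded (H : ℤ → Submodule K (Fin m → K)) (i : ℤ) :
    Submodule K (Matrix (Fin m) (Fin m) K) where
  carrier := {ξ | ∀ p, ∀ x ∈ H p, ξ.mulVec x ∈ H (p - i)}
  zero_mem' p x _ := by
    rw [Matrix.zero_mulVec]
    exact zero_mem _
  add_mem' hξ hη p x hx := by
    rw [Matrix.add_mulVec]
    exact add_mem (hξ p x hx) (hη p x hx)
  smul_mem' c ξ hξ p x hx := by
    rw [Matrix.smul_mulVec]
    exact Submodule.smul_mem _ c (hξ p x hx)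

end Gradings

end TensorFlag

end

open TensorFlag

/-! Two opposed filtrations have a common adapted basis: the columns of `B` run through bases of the
pieces `H^{p,w-p}`, and the `k`-th column has degree `d k` for `F` and `w - d k` for `F_c`. In these
coordinates tensor filtrations are read off from the weights of basis tensors. Membership in both
middle steps bounds the weight from both sides, so the type `(a, b)` component of every element of
`U` is homogeneous of weight `w(a - b)/2` (`weight_eq_of_mem_midTensors`). The rest of the argument
rests on this purity.

The flags opposed to `F_c` form an open neighbourhood of `F` (`isOpen_opposed`), and each is the
translate of `F` by `B n B⁻¹` with `n` unipotent and lowering degrees (`exists_isUnip_of_opposed`).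
Applying `n⁻¹` to a pure tensor gives the tensor itself plus terms of strictly smaller weight. If
the translated flag lies in `Y`, the middle condition forbids those terms, so `B n B⁻¹` lies in `G`
(`conj_mem_stabilizer_of_mid`). The diagonal torus contracts `n` to `1` along a polynomial curve
inside `G`, so `B n B⁻¹` even lies in the identity component (`conj_mem_identityComponent`). Thus
near `F` the locus `Y` is contained in the orbit of the identity component. As that component is
irreducible and `Y` is closed, the orbit closure is the only component through `F`.

The torus multiplies each component of a pure tensor by a power of `z`. Hence it normalizes `G`, and
lies in `G` when the exponents vanish; a Vandermonde-type argument then splits `𝔤` into weight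
spaces (`endPart_mem_lieAlgebra`). The unipotent argument is valid over every `K`-algebra. Over the
dual numbers it computes the tangent space: a deformation of `F` is the translate by `1 + ε ξ` for a
unique `ξ` strictly lowering degrees, and it stays in `Y` exactly when `ξ ∈ 𝔤`. -/

noncomputable section

namespace TensorFlag

/-! ### Homogeneous Noetherian spaces -/

section Topology

open TopologicalSpace

/-- In a Noetherian space with a transitive group of homeomorphisms, connected components are
irreducible. -/
theorem isIrreducible_connectedComponent {X : Type*} [TopologicalSpace X] [NoetherianSpace X]
    (hX : ∀ x y : X, ∃ e : X ≃ₜ X, e x = y) (x : X) : IsIrreducible (connectedComponent x) := by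
  obtain ⟨o, ho, ⟨x₀, hx₀⟩, hoZ⟩ := NoetherianSpace.exists_isOpen_nonempty_subset_irreducibleComponent
    (irreducibleComponent x) (irreducibleComponent_mem_irreducibleComponents x)
  -- By homogeneity every point inherits from `x₀` an open neighbourhood contained in a closed
  -- irreducible set.
  have key : ∀ y : X, ∃ o W : Set X, IsOpen o ∧ y ∈ o ∧ o ⊆ W ∧ IsClosed W ∧ IsIrreducible W := by
    intro y
    obtain ⟨e, rfl⟩ := hX x₀ y
    exact ⟨e '' o, e '' irreducibleComponent x, e.isOpenMap o ho, Set.mem_image_of_mem e hx₀,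
      Set.image_mono hoZ, e.isClosedMap _ isClosed_irreducibleComponent,
      isIrreducible_irreducibleComponent.image e e.continuous.continuousOn⟩
  -- The neighbourhood of `y` meets the component in a dense subset, so the component lies in `W`
  -- and equals it by maximality. The component is therefore clopen.
  have hopen : IsOpen (irreducibleComponent x) := by
    refine isOpen_iff_forall_mem_open.2 fun y hy => ?_
    obtain ⟨o, W, ho, hyo, hoW, hW, hWi⟩ := key y
    have h1 : irreducibleComponent x ⊆ W :=
      (subset_closure_inter_of_isPreirreducible_of_isOpen
        isIrreducible_irreducibleComponent.isPreirreducible ho ⟨y, hy, hyo⟩).trans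
        (closure_minimal (Set.inter_subset_right.trans hoW) hW)
    have h2 : W = irreducibleComponent x := Set.Subset.antisymm
      ((irreducibleComponent_mem_irreducibleComponents x).2 hWi h1) h1
    exact ⟨o, h2 ▸ hoW, ho, hyo⟩
  have : connectedComponent x = irreducibleComponent x :=
    Set.Subset.antisymm
      (IsClopen.connectedComponent_subset ⟨isClosed_irreducibleComponent, hopen⟩
        mem_irreducibleComponent)
      irreducibleComponent_subset_connectedComponent
  rw [this]
  exact isIrreducible_irreducibleComponent

end Topology

/-! ### Regular functions and connectedness in the Zariski topology of `GL_m(K)` -/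

section Zariski

variable {m : ℕ} {K : Type u} [Field K]

attribute [local instance] zariskiGL

theorem mem_preimage_zeroLocus_iff {S : Set (MvPolynomial (Fin m × Fin m) K)}
    {g : GL (Fin m) K} :
    g ∈ (fun g : GL (Fin m) K => MvPolynomial.pointToPoint (k := K)
      (fun ij : Fin m × Fin m => g.1 ij.1 ij.2)) ⁻¹' PrimeSpectrum.zeroLocus S ↔
      g ∈ {g : GL (Fin m) K | ∀ P ∈ S, MvPolynomial.eval (fun ij => g.1 ij.1 ij.2) P = 0} := by
  rw [Set.mem_preimage, PrimeSpectrum.mem_zeroLocus]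
  exact forall₂_congr fun P _ => MvPolynomial.mem_vanishingIdeal_singleton_iff _ _

/-- `pointToPoint` sends `g` to the ideal of polynomials vanishing at its entries, so closed sets
are common zero sets of polynomials in the entries; the inverse determinant is not needed. -/
theorem isClosed_GL_iff {C : Set (GL (Fin m) K)} :
    IsClosed C ↔ ∃ S : Set (MvPolynomial (Fin m × Fin m) K),
      C = {g | ∀ P ∈ S, MvPolynomial.eval (fun ij => g.1 ij.1 ij.2) P = 0} := by
  rw [isClosed_induced_iff]
  constructor
  · rintro ⟨t, ht, rfl⟩
    obtain ⟨S, rfl⟩ := (PrimeSpectrum.isClosed_iff_zeroLocus _).1 ht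
    exact ⟨S, Set.ext fun g => mem_preimage_zeroLocus_iff⟩
  · rintro ⟨S, rfl⟩
    exact ⟨PrimeSpectrum.zeroLocus S, PrimeSpectrum.isClosed_zeroLocus S,
      Set.ext fun g => mem_preimage_zeroLocus_iff⟩

instance noetherianSpace_GL : TopologicalSpace.NoetherianSpace (GL (Fin m) K) :=
  Topology.IsInducing.noetherianSpace (Topology.IsInducing.mk rfl)

/-- A map to `GL_m(K)` is Zariski continuous if its entries lie in an algebra of functions with
closed zero sets. -/
theorem continuous_GL_of_entries {X : Type*} [TopologicalSpace X] (R : Subalgebra K (X → K))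
    (hR : ∀ f ∈ R, IsClosed {x | f x = 0}) (φ : X → GL (Fin m) K)
    (hφ : ∀ k l, (fun x => (φ x).1 k l) ∈ R) : Continuous φ := by
  refine continuous_iff_isClosed.2 fun C hC => ?_
  obtain ⟨S, rfl⟩ := isClosed_GL_iff.1 hC
  have hP : ∀ P : MvPolynomial (Fin m × Fin m) K,
      (fun x => MvPolynomial.eval (fun ij => (φ x).1 ij.1 ij.2) P) ∈ R := by
    intro P
    induction P using MvPolynomial.induction_on with
    | C c => 
      simp only [MvPolynomial.eval_C]
      exact R.algebraMap_mem c
    | add p q hp hq => 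
      simp only [map_add]
      exact R.add_mem hp hq
    | mul_X p n hp => 
      simp only [map_mul, MvPolynomial.eval_X]
      exact R.mul_mem hp (hφ n.1 n.2)
  have : φ ⁻¹' {g | ∀ P ∈ S, MvPolynomial.eval (fun ij => g.1 ij.1 ij.2) P = 0} =
      ⋂ P ∈ S, {x | MvPolynomial.eval (fun ij => (φ x).1 ij.1 ij.2) P = 0} := by
    ext x
    simp
  rw [this]
  exact isClosed_biInter fun P _ => hR _ (hP P)

/-- The regular functions on `GL_m(K)`. -/
def regularFunctions (m : ℕ) (K : Type u) [Field K] : Subalgebra K (GL (Fin m) K → K) where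
  -- The power of the determinant clears denominators. It never vanishes, so zero sets remain zero
  -- sets of polynomials.
  carrier := {f | ∃ (P : MvPolynomial (Fin m × Fin m) K) (n : ℕ), ∀ g : GL (Fin m) K,
    f g * g.1.det ^ n = MvPolynomial.eval (fun ij => g.1 ij.1 ij.2) P}
  mul_mem' := by
    rintro f f' ⟨P, n, hP⟩ ⟨P', n', hP'⟩
    refine ⟨P * P', n + n', fun g => ?_⟩
    rw [map_mul, ← hP, ← hP', Pi.mul_apply]
    ring
  add_mem' := by
    rintro f f' ⟨P, n, hP⟩ ⟨P', n', hP'⟩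
    refine ⟨P * (Matrix.det (Matrix.of fun k l => MvPolynomial.X (k, l))) ^ n' +
      P' * (Matrix.det (Matrix.of fun k l => MvPolynomial.X (k, l))) ^ n, n + n', fun g => ?_⟩
    have hd : MvPolynomial.eval (fun ij => g.1 ij.1 ij.2)
        (Matrix.det (Matrix.of fun k l : Fin m => MvPolynomial.X (R := K) (k, l))) = g.1.det := by
      rw [RingHom.map_det]
      congr 1
      ext k l
      simp
    rw [map_add, map_mul, map_mul, map_pow, map_pow, hd, ← hP, ← hP', Pi.add_apply]
    ring
  algebraMap_mem' c := ⟨MvPolynomial.C c, 0, fun g => by simp⟩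

theorem isClosed_zeros_of_mem_regularFunctions {f : GL (Fin m) K → K}
    (hf : f ∈ regularFunctions m K) : IsClosed {g | f g = 0} := by
  obtain ⟨P, n, hP⟩ := hf
  refine isClosed_GL_iff.2 ⟨{P}, ?_⟩
  ext g
  have hd : g.1.det ≠ 0 := ((Matrix.isUnit_iff_isUnit_det _).1 g.isUnit).ne_zero
  simp [← hP, hd]

theorem entry_mem_regularFunctions (k l : Fin m) :
    (fun g : GL (Fin m) K => g.1 k l) ∈ regularFunctions m K :=
  ⟨MvPolynomial.X (k, l), 0, fun g => by simp⟩

theorem matrix_det_mem {X : Type*} (R : Subalgebra K (X → K)) {M : X → Matrix (Fin m) (Fin m) K}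
    (hM : ∀ k l, (fun x => M x k l) ∈ R) : (fun x => (M x).det) ∈ R := by
  have : (fun x => (M x).det) = Matrix.det (Matrix.of fun k l x => M x k l) := by
    funext x
    rw [← Pi.evalRingHom_apply (fun _ => K) x (Matrix.det _), RingHom.map_det]
    rfl
  rw [this, Matrix.det_apply]
  refine R.sum_mem fun σ _ => ?_
  rw [Units.smul_def]
  exact R.toSubring.zsmul_mem (R.prod_mem fun i _ => hM _ _) _

theorem matrix_mul_mem {X : Type*} (R : Subalgebra K (X → K)) {M N : X → Matrix (Fin m) (Fin m) K}
    (hM : ∀ k l, (fun x => M x k l) ∈ R) (hN : ∀ k l, (fun x => N x k l) ∈ R) (k l : Fin m) :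
    (fun x => (M x * N x) k l) ∈ R := by
  have : (fun x => (M x * N x) k l) = ∑ s, (fun x => M x k s) * fun x => N x s l := by
    funext x
    simp [Matrix.mul_apply]
  rw [this]
  exact R.sum_mem fun s _ => R.mul_mem (hM _ _) (hN _ _)

theorem const_mem {X : Type*} (R : Subalgebra K (X → K)) (c : K) : (fun _ => c) ∈ R :=
  R.algebraMap_mem c

/-- Cramer's rule: the adjugate is polynomial in the entries, and one factor `det` clears the
denominator. -/
theorem inv_entry_mem_regularFunctions (k l : Fin m) :
    (fun g : GL (Fin m) K => (g⁻¹).1 k l) ∈ regularFunctions m K := by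
  obtain ⟨P, hP⟩ : ∃ P : MvPolynomial (Fin m × Fin m) K, ∀ g : GL (Fin m) K,
      g.1.adjugate k l = MvPolynomial.eval (fun ij => g.1 ij.1 ij.2) P := by
    refine ⟨(Matrix.of fun k l : Fin m => MvPolynomial.X (R := K) (k, l)).adjugate k l,
      fun g => ?_⟩
    have := RingHom.map_adjugate (MvPolynomial.eval (fun ij : Fin m × Fin m => g.1 ij.1 ij.2))
      (Matrix.of fun k l : Fin m => MvPolynomial.X (R := K) (k, l))
    have h2 : (MvPolynomial.eval (fun ij : Fin m × Fin m => g.1 ij.1 ij.2)).mapMatrix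
      (Matrix.of fun k l : Fin m => MvPolynomial.X (R := K) (k, l)) = g.1 := by
      ext k l
      simp
    rw [h2] at this
    rw [← this]
    rfl
  refine ⟨P, 1, fun g => ?_⟩
  have hd : g.1.det ≠ 0 := ((Matrix.isUnit_iff_isUnit_det _).1 g.isUnit).ne_zero
  rw [← hP]
  change (g⁻¹).1 k l * _ = _
  rw [Matrix.coe_units_inv, Matrix.inv_def]
  simp [hd, mul_comm]

theorem continuous_mul_left_GL (g₀ : GL (Fin m) K) : Continuous fun g => g₀ * g :=
  continuous_GL_of_entries (regularFunctions m K) (fun _ => isClosed_zeros_of_mem_regularFunctions)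
    _ (matrix_mul_mem _ (fun _ _ => const_mem _ _) entry_mem_regularFunctions)

/-- The identity component of a subgroup of `GL_m(K)` is irreducible. -/
theorem isIrreducible_connectedComponentIn (H : Subgroup (GL (Fin m) K)) :
    IsIrreducible (connectedComponentIn (H : Set (GL (Fin m) K)) 1) := by
  have hc : ∀ h : H, Continuous fun x : H => h * x := fun h =>
    Continuous.subtype_mk ((continuous_mul_left_GL h.1).comp continuous_subtype_val) _
  rw [connectedComponentIn_eq_image (F := (H : Set (GL (Fin m) K))) (x := 1) H.one_mem]
  have : TopologicalSpace.NoetherianSpace (H : Set (GL (Fin m) K)) :=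
    Topology.IsInducing.subtypeVal.noetherianSpace
  -- Left translation by `y * x⁻¹` moves `x` to `y`; only continuity of left translations is
  -- required.
  refine (isIrreducible_connectedComponent (X := (H : Set (GL (Fin m) K)))
    (fun x y => ⟨⟨Equiv.mulLeft ((y * x⁻¹ : H)), ?_, ?_⟩, ?_⟩) _).image _
    continuous_subtype_val.continuousOn
  · exact hc (y * x⁻¹ : H)
  · exact hc (y * x⁻¹ : H)⁻¹
  · exact inv_mul_cancel_right (G := H) y x

/-- The algebra of polynomial functions on the affine line. -/
def polynomialFunctions (K : Type u) [Field K] : Subalgebra K (CofiniteTopology K → K) where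
  carrier := {f | ∃ p : Polynomial K, ∀ z, f (CofiniteTopology.of z) = p.eval z}
  mul_mem' := by
    rintro f f' ⟨p, hp⟩ ⟨p', hp'⟩
    exact ⟨p * p', fun z => by simp [hp, hp']⟩
  add_mem' := by
    rintro f f' ⟨p, hp⟩ ⟨p', hp'⟩
    exact ⟨p + p', fun z => by simp [hp, hp']⟩
  algebraMap_mem' c := ⟨Polynomial.C c, fun g => by simp⟩

/-- The affine line is modelled by the cofinite topology: a polynomial vanishes identically or at
finitely many points. -/
theorem isClosed_zeros_of_mem_polynomialFunctions {f : CofiniteTopology K → K}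
    (hf : f ∈ polynomialFunctions K) : IsClosed {z | f z = 0} := by
  obtain ⟨p, hp⟩ := hf
  rw [CofiniteTopology.isClosed_iff]
  by_cases h0 : p = 0
  · left
    ext z
    obtain ⟨z, rfl⟩ := CofiniteTopology.of.surjective z
    simp [hp, h0]
  · right
    refine ((p.rootSet_finite K).image CofiniteTopology.of).subset fun z hz => ?_
    obtain ⟨z, rfl⟩ := CofiniteTopology.of.surjective z
    refine ⟨z, ?_, rfl⟩
    simpa [Polynomial.mem_rootSet, h0, ← hp] using hz

/-- A polynomial curve in a subgroup of `GL_m(K)` through `1` lies in the identity component. -/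
theorem mem_connectedComponentIn_of_curve [Infinite K] (H : Set (GL (Fin m) K))
    (c : K → GL (Fin m) K) (hc : ∀ k l, ∃ p : Polynomial K, ∀ z, (c z).1 k l = p.eval z)
    (hcH : ∀ z, c z ∈ H) (z₀ : K) (hz₀ : c z₀ = 1) (z : K) : c z ∈ connectedComponentIn H 1 := by
  have hcont : Continuous (c ∘ CofiniteTopology.of.symm) :=
    continuous_GL_of_entries (polynomialFunctions K)
      (fun _ => isClosed_zeros_of_mem_polynomialFunctions) _ fun k l => by
        obtain ⟨p, hp⟩ := hc k l
        exact ⟨p, fun z => by simp [hp]⟩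
  -- An infinite set with the cofinite topology is connected, hence so is the image of the curve.
  have hpre : IsPreconnected (Set.range (c ∘ CofiniteTopology.of.symm)) :=
    isPreconnected_range hcont
  refine hpre.subset_connectedComponentIn ⟨CofiniteTopology.of z₀, by simpa using hz₀⟩ ?_
    ⟨CofiniteTopology.of z, by simp⟩
  rintro _ ⟨z, rfl⟩
  exact hcH _

end Zariski

/-! ### Filtrations adapted to a weighted basis -/

section Weights

variable {m : ℕ} {A : Type u} [CommRing A] {a b : ℕ}

theorem Tensor.act_add (g : GL (Fin m) A) (t t' : Tensor m A a b) :
    Tensor.act g (t + t') = Tensor.act g t + Tensor.act g t' := by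
  funext i j
  simp [Tensor.act, mul_add, Finset.sum_add_distrib]

theorem Tensor.act_smul (g : GL (Fin m) A) (c : A) (t : Tensor m A a b) :
    Tensor.act g (c • t) = c • Tensor.act g t := by
  funext i j
  simp only [Tensor.act, Pi.smul_apply, smul_eq_mul, Finset.mul_sum]
  exact Finset.sum_congr rfl fun _ _ => Finset.sum_congr rfl fun _ _ => by ring

/-- The action of an element of `GL_m(A)` on tensors, as a linear map. -/
def Tensor.actLin (a b : ℕ) (g : GL (Fin m) A) : Tensor m A a b →ₗ[A] Tensor m A a b where
  toFun := Tensor.act g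
  map_add' := Tensor.act_add g
  map_smul' := Tensor.act_smul g

theorem Tensor.act_inv_act (g : GL (Fin m) A) (t : Tensor m A a b) :
    Tensor.act g⁻¹ (Tensor.act g t) = t := by
  rw [← Tensor.act_mul, inv_mul_cancel, Tensor.act_one]

theorem Tensor.act_act_inv (g : GL (Fin m) A) (t : Tensor m A a b) :
    Tensor.act g (Tensor.act g⁻¹ t) = t := by
  rw [← Tensor.act_mul, mul_inv_cancel, Tensor.act_one]

theorem act_pureTensor (g : GL (Fin m) A) (x : Fin a → Fin m → A) (φ : Fin b → Fin m → A) :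
    Tensor.act g (pureTensor x φ) =
      pureTensor (fun s => g.1.mulVec (x s)) (fun s => (g⁻¹).1.vecMul (φ s)) := by
  funext i j
  simp only [Tensor.act, pureTensor, Matrix.mulVec, Matrix.vecMul, dotProduct,
    Finset.prod_univ_sum, Fintype.piFinset_univ, Finset.sum_mul_sum, Finset.prod_mul_distrib]
  exact Finset.sum_congr rfl fun _ _ => Finset.sum_congr rfl fun _ _ => by ring

theorem inv_mulVec_mulVec (g : GL (Fin m) A) (x : Fin m → A) :
    (g⁻¹).1.mulVec (g.1.mulVec x) = x := by
  rw [Matrix.mulVec_mulVec, ← Units.val_mul, inv_mul_cancel, Units.val_one, Matrix.one_mulVec]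

theorem mulVec_inv_mulVec (g : GL (Fin m) A) (x : Fin m → A) :
    g.1.mulVec ((g⁻¹).1.mulVec x) = x := by
  rw [Matrix.mulVec_mulVec, ← Units.val_mul, mul_inv_cancel, Units.val_one, Matrix.one_mulVec]

theorem mem_map_glEquiv {g : GL (Fin m) A} {P : Submodule A (Fin m → A)} {x : Fin m → A} :
    x ∈ P.map (glEquiv g : (Fin m → A) →ₗ[A] (Fin m → A)) ↔ (g⁻¹).1.mulVec x ∈ P := by
  constructor
  · rintro ⟨y, hy, rfl⟩
    change (g⁻¹).1.mulVec (g.1.mulVec y) ∈ P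
    rwa [inv_mulVec_mulVec]
  · exact fun h => ⟨_, h, mulVec_inv_mulVec g x⟩

theorem act_mem_tensorFiltration (g : GL (Fin m) A) {F F' : ℤ → Submodule A (Fin m → A)}
    (hF : ∀ p, F' p = (F p).map (glEquiv g : (Fin m → A) →ₗ[A] (Fin m → A))) {k : ℤ}
    {t : Tensor m A a b} (ht : t ∈ tensorFiltration F a b k) :
    Tensor.act g t ∈ tensorFiltration F' a b k := by
  change t ∈ (tensorFiltration F' a b k).comap (Tensor.actLin a b g)
  refine (Submodule.span_le.2 ?_) ht
  rintro _ ⟨p, q, x, φ, hk, hx, hφ, rfl⟩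
  refine Submodule.subset_span ⟨p, q, _, _, hk, fun s => ?_, fun s => ?_, act_pureTensor g x φ⟩
  · rw [hF, mem_map_glEquiv, inv_mulVec_mulVec]
    exact hx s
  · intro y hy
    rw [hF, mem_map_glEquiv] at hy
    rw [← Matrix.dotProduct_mulVec]
    exact hφ s _ hy

/-- The filtration of `A ^ m` for which the basis vector `e_k` has degree `d k`. -/
def stdFil (A : Type u) [CommRing A] (d : Fin m → ℤ) (p : ℤ) : Submodule A (Fin m → A) where
  carrier := {x | ∀ k, d k < p → x k = 0}
  add_mem' hx hy k hk := by rw [Pi.add_apply, hx k hk, hy k hk, add_zero]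
  zero_mem' _ _ := rfl
  smul_mem' c x hx k hk := by rw [Pi.smul_apply, hx k hk, smul_zero]

/-- The filtration of `A ^ m` for which the `k`-th column of `g` has degree `d k`. -/
def adaptedFil (g : GL (Fin m) A) (d : Fin m → ℤ) (p : ℤ) : Submodule A (Fin m → A) :=
  (stdFil A d p).map (glEquiv g : (Fin m → A) →ₗ[A] (Fin m → A))

theorem mem_adaptedFil {g : GL (Fin m) A} {d : Fin m → ℤ} {p : ℤ} {x : Fin m → A} :
    x ∈ adaptedFil g d p ↔ ∀ k, d k < p → (g⁻¹).1.mulVec x k = 0 :=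
  mem_map_glEquiv

theorem adaptedFil_mul (g g' : GL (Fin m) A) (d : Fin m → ℤ) (p : ℤ) :
    adaptedFil (g * g') d p =
      (adaptedFil g' d p).map (glEquiv g : (Fin m → A) →ₗ[A] (Fin m → A)) := by
  ext x
  rw [mem_map_glEquiv, adaptedFil, adaptedFil, mem_map_glEquiv, mem_map_glEquiv, mul_inv_rev,
    Units.val_mul, Matrix.mulVec_mulVec]

theorem single_mem_stdFil {d : Fin m → ℤ} {k : Fin m} {p : ℤ} (hp : p ≤ d k) (c : A) :
    Pi.single k c ∈ stdFil A d p := by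
  intro l hl
  rw [Pi.single_eq_of_ne]
  rintro rfl
  exact absurd hp (not_le.2 hl)

/-- The shift in `1 - q` is what gives the dual basis vector `e^k` degree exactly `-d k`: the
vectors `e_k` in `F^{1-q}` are those with `-d k < q`. -/
theorem mem_dualFiltration_stdFil {d : Fin m → ℤ} {q : ℤ} {φ : Fin m → A} :
    φ ∈ dualFiltration (stdFil A d) q ↔ ∀ k, -d k < q → φ k = 0 := by
  constructor
  · intro h k hk
    simpa using h (Pi.single k 1) (single_mem_stdFil (by omega) 1)
  · intro h x hx
    refine Finset.sum_eq_zero fun k _ => ?_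
    by_cases hk : -d k < q
    · rw [h k hk, zero_mul]
    · rw [hx k (by omega), mul_zero]

/-- The weight of the basis tensor `e_{i 1} ⊗ ⋯ ⊗ e_{i a} ⊗ e^{j 1} ⊗ ⋯ ⊗ e^{j b}` if `e_k` has
weight `d k`. -/
def weight (d : Fin m → ℤ) (i : Fin a → Fin m) (j : Fin b → Fin m) : ℤ :=
  ∑ s, d (i s) - ∑ s, d (j s)

/-- A nonzero coordinate of a generator forces each factor's degree to be at most that of the
corresponding basis vector, and these inequalities add up. Conversely, a tensor expands into basis
tensors, each of which is a generator in its own weight. -/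
theorem mem_tensorFiltration_stdFil {d : Fin m → ℤ} {k : ℤ} {t : Tensor m A a b} :
    t ∈ tensorFiltration (stdFil A d) a b k ↔ ∀ i j, weight d i j < k → t i j = 0 := by
  constructor
  · intro ht i j hij
    induction ht using Submodule.span_induction with
    | mem t ht =>
      obtain ⟨p, q, x, φ, hk, hx, hφ, rfl⟩ := ht
      by_contra hne
      have hx' : ∀ s, p s ≤ d (i s) := fun s => by
        by_contra hs
        exact hne (mul_eq_zero_of_left
          (Finset.prod_eq_zero (Finset.mem_univ s) (hx s _ (not_le.1 hs))) _)
      have hφ' : ∀ s, q s ≤ -d (j s) := fun s => by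
        by_contra hs
        exact hne (mul_eq_zero_of_right _ (Finset.prod_eq_zero (Finset.mem_univ s)
          (mem_dualFiltration_stdFil.1 (hφ s) _ (not_le.1 hs))))
      have h1 := Finset.sum_le_sum fun s (_ : s ∈ Finset.univ) => hx' s
      have h2 := Finset.sum_le_sum fun s (_ : s ∈ Finset.univ) => hφ' s
      rw [Finset.sum_neg_distrib] at h2
      unfold weight at hij
      omega
    | zero => rfl
    | add t t' _ _ h h' => rw [Pi.add_apply, Pi.add_apply, h, h', add_zero]
    | smul c t _ h => rw [Pi.smul_apply, Pi.smul_apply, h, smul_zero]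
  · intro h
    have ht : t = ∑ i, ∑ j, t i j • pureTensor (fun s => Pi.single (i s) (1 : A))
        (fun s => Pi.single (j s) (1 : A)) := by
      funext i j
      have hp : ∀ {n : ℕ} (f g : Fin n → Fin m),
          ∏ s, (Pi.single (f s) (1 : A) : Fin m → A) (g s) = if f = g then 1 else 0 := by
        intro n f g
        rw [← prod_one_apply]
        exact Finset.prod_congr rfl fun s _ => by
          rw [Matrix.one_apply, Pi.single_apply]
          exact if_congr eq_comm rfl rfl
      simp [Finset.sum_apply, pureTensor, hp]
    rw [ht]
    refine Submodule.sum_mem _ fun i _ => Submodule.sum_mem _ fun j _ => ?_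
    by_cases hk : weight d i j < k
    · rw [h i j hk, zero_smul]
      exact Submodule.zero_mem _
    · refine Submodule.smul_mem _ _ (Submodule.subset_span ⟨fun s => d (i s), fun s => -d (j s),
        _, _, ?_, fun s => single_mem_stdFil le_rfl 1, fun s => ?_, rfl⟩)
      · rw [Finset.sum_neg_distrib, ← sub_eq_add_neg]
        exact not_lt.1 hk
      · refine mem_dualFiltration_stdFil.2 fun l hl => ?_
        rw [Pi.single_eq_of_ne]
        rintro rfl
        exact absurd hl (lt_irrefl _)

theorem mem_tensorFiltration_adaptedFil {g : GL (Fin m) A} {d : Fin m → ℤ} {k : ℤ}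
    {t : Tensor m A a b} :
    t ∈ tensorFiltration (adaptedFil g d) a b k ↔
      ∀ i j, weight d i j < k → Tensor.act g⁻¹ t i j = 0 := by
  rw [← mem_tensorFiltration_stdFil]
  constructor
  · refine act_mem_tensorFiltration g⁻¹ fun p => ?_
    ext x
    rw [mem_map_glEquiv, adaptedFil, mem_map_glEquiv, inv_inv, inv_mulVec_mulVec]
  · intro h
    rw [← Tensor.act_act_inv g t]
    exact act_mem_tensorFiltration g (fun p => rfl) h

/-- Doubling the weight treats both parities at once: for odd total weight the middle step is zero
and there is no nonzero coordinate to test. -/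
theorem le_weight_of_mem_midTensors {w : ℤ} {g : GL (Fin m) A} {d : Fin m → ℤ}
    {t : Tensor m A a b} (ht : t ∈ midTensors w (adaptedFil g d) a b) (i : Fin a → Fin m)
    (j : Fin b → Fin m) (hij : Tensor.act g⁻¹ t i j ≠ 0) :
    w * ((a : ℤ) - b) ≤ 2 * weight d i j := by
  unfold midTensors at ht
  split_ifs at ht with he
  · obtain ⟨c, hc⟩ := he
    by_contra hlt
    refine hij (mem_tensorFiltration_adaptedFil.1 ht i j ?_)
    omega
  · rw [Submodule.mem_bot] at ht
    rw [ht] at hij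
    exact absurd (congrFun (congrFun (map_zero (Tensor.actLin a b g⁻¹)) i) j) hij

/-- In the odd case no basis tensor can satisfy the weight equation, so the tensor is zero, as the
middle step demands. -/
theorem mem_midTensors_of_weight_eq {w : ℤ} {g : GL (Fin m) A} {d : Fin m → ℤ}
    {t : Tensor m A a b} (ht : ∀ i j, Tensor.act g⁻¹ t i j ≠ 0 →
      2 * weight d i j = w * ((a : ℤ) - b)) : t ∈ midTensors w (adaptedFil g d) a b := by
  unfold midTensors
  split_ifs with he
  · refine mem_tensorFiltration_adaptedFil.2 fun i j hij => ?_
    by_contra hne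
    have := ht i j hne
    omega
  · rw [Submodule.mem_bot, ← Tensor.act_act_inv g t]
    have h0 : Tensor.act g⁻¹ t = 0 := by
      funext i j
      by_contra hne
      exact he ⟨weight d i j, by rw [← ht i j hne, two_mul]⟩
    rw [h0]
    exact map_zero (Tensor.actLin a b g)

/-- Passing to the opposed filtration reflects weights about half the total weight, turning its
lower bound into an upper bound. -/
theorem weight_sub {w : ℤ} {d : Fin m → ℤ} (i : Fin a → Fin m) (j : Fin b → Fin m) :
    weight (fun k => w - d k) i j = w * ((a : ℤ) - b) - weight d i j := by
  simp only [weight, Finset.sum_sub_distrib, Finset.sum_const, Finset.card_univ, Fintype.card_fin,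
    nsmul_eq_mul]
  ring

/-- A tensor in the middle steps of two opposed filtrations is homogeneous of half the weight. -/
theorem weight_eq_of_mem_midTensors {w : ℤ} {g : GL (Fin m) A} {d : Fin m → ℤ}
    {t : Tensor m A a b} (ht : t ∈ midTensors w (adaptedFil g d) a b)
    (ht' : t ∈ midTensors w (adaptedFil g fun k => w - d k) a b) (i : Fin a → Fin m)
    (j : Fin b → Fin m) (hij : Tensor.act g⁻¹ t i j ≠ 0) :
    2 * weight d i j = w * ((a : ℤ) - b) := by
  have h1 := le_weight_of_mem_midTensors ht i j hij
  have h2 := le_weight_of_mem_midTensors ht' i j hij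
  rw [weight_sub] at h2
  omega

/-! ### Unipotent matrices -/

/-- `M` is the identity on the graded pieces, and maps each vector of degree `d l` to itself
modulo vectors of smaller degree. -/
def IsUnip (d : Fin m → ℤ) (M : Matrix (Fin m) (Fin m) A) : Prop :=
  ∀ k l, d l ≤ d k → M k l = (1 : Matrix (Fin m) (Fin m) A) k l

theorem IsUnip.blockTriangular {d : Fin m → ℤ} {M : Matrix (Fin m) (Fin m) A} (hM : IsUnip d M) :
    M.BlockTriangular d := fun k l hkl => by
  rw [hM k l hkl.le, Matrix.one_apply_ne]
  rintro rfl
  exact lt_irrefl _ hkl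

theorem IsUnip.det {d : Fin m → ℤ} {M : Matrix (Fin m) (Fin m) A} (hM : IsUnip d M) :
    M.det = 1 := by
  rw [hM.blockTriangular.det]
  refine Finset.prod_eq_one fun p _ => ?_
  have : M.toSquareBlock d p = 1 := by
    ext ⟨k, hk⟩ ⟨l, hl⟩
    simp only [Matrix.toSquareBlock_def, Matrix.of_apply]
    rw [hM k l (hl.trans hk.symm).le, Matrix.one_apply, Matrix.one_apply]
    simp
  rw [this, Matrix.det_one]

/-- The inverse is again block triangular. In the sum for the entry `(k, l)` of `g * g⁻¹ = 1` with
`d l ≤ d k`, terms with `d s ≤ d k` see only the identity part of `g`, and terms with `d s > d k`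
vanish by triangularity of the inverse. -/
theorem IsUnip.inv {d : Fin m → ℤ} {g : GL (Fin m) A} (hg : IsUnip d g.1) :
    IsUnip d (g⁻¹).1 := by
  have hbt : (g⁻¹).1.BlockTriangular d := by
    rw [Matrix.coe_units_inv]
    have : Invertible g.1 := g.invertible
    exact Matrix.blockTriangular_inv_of_blockTriangular hg.blockTriangular
  intro k l hkl
  have h1 : (g.1 * (g⁻¹).1) k l = (1 : Matrix (Fin m) (Fin m) A) k l := by
    rw [← Units.val_mul, mul_inv_cancel, Units.val_one]
  rw [← h1, Matrix.mul_apply, Finset.sum_eq_single k]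
  · rw [hg k k le_rfl, Matrix.one_apply_eq, one_mul]
  · intro s _ hs
    rcases le_or_gt (d s) (d k) with hsk | hsk
    · rw [hg k s hsk, Matrix.one_apply_ne hs.symm, zero_mul]
    · rw [hbt (hkl.trans_lt hsk), mul_zero]
  · exact fun h => absurd (Finset.mem_univ k) h

/-- The element of `GL_m(A)` given by a unipotent matrix. -/
def unipGL {d : Fin m → ℤ} {M : Matrix (Fin m) (Fin m) A} (hM : IsUnip d M) : GL (Fin m) A :=
  Matrix.GeneralLinearGroup.mk'' M (hM.det ▸ isUnit_one)

theorem unipGL_val {d : Fin m → ℤ} {M : Matrix (Fin m) (Fin m) A} (hM : IsUnip d M) :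
    (unipGL hM).1 = M :=
  rfl

/-- A unipotent matrix changes a multi-index only by strictly lowering degrees, so its action on
tensors is the identity plus terms of strictly smaller weight. -/
theorem IsUnip.le_of_ne_zero {d : Fin m → ℤ} {M : Matrix (Fin m) (Fin m) A} (hM : IsUnip d M)
    {n : ℕ} {i i' : Fin n → Fin m} (h : ∏ s, M (i s) (i' s) ≠ 0) :
    i = i' ∨ ∑ s, d (i s) < ∑ s, d (i' s) := by
  have hs : ∀ s, i s = i' s ∨ d (i s) < d (i' s) := by
    intro s
    by_contra! hs
    refine h (Finset.prod_eq_zero (Finset.mem_univ s) ?_)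
    rw [hM _ _ hs.2, Matrix.one_apply_ne hs.1]
  by_cases hi : i = i'
  · exact Or.inl hi
  · obtain ⟨s, hs'⟩ := Function.ne_iff.1 hi
    exact Or.inr (Finset.sum_lt_sum
      (fun s _ => (hs s).elim (fun h => (congrArg d h).le) le_of_lt)
      ⟨s, Finset.mem_univ s, (hs s).resolve_left hs'⟩)

/-- If `t` is homogeneous and its image under a unipotent element has no components of smaller
weight, then `t` is fixed. -/
theorem act_eq_of_isUnip {d : Fin m → ℤ} {c : ℤ} {g : GL (Fin m) A} (hg : IsUnip d g.1)
    {t : Tensor m A a b} (ht : ∀ i j, t i j ≠ 0 → 2 * weight d i j = c)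
    (ht' : ∀ i j, Tensor.act g t i j ≠ 0 → c ≤ 2 * weight d i j) : Tensor.act g t = t := by
  -- An off-diagonal contribution would come from a coordinate of strictly larger weight, but `t`
  -- has nothing above weight `c / 2`.
  have key : ∀ i j i' j', c ≤ 2 * weight d i j → ¬ (i' = i ∧ j' = j) →
      (∏ s, g.1 (i s) (i' s)) * (∏ s, (g⁻¹).1 (j' s) (j s)) * t i' j' = 0 := by
    intro i j i' j' hc hne
    by_contra h0
    have h1 := hg.le_of_ne_zero (left_ne_zero_of_mul (left_ne_zero_of_mul h0))
    have h2 := hg.inv.le_of_ne_zero (right_ne_zero_of_mul (left_ne_zero_of_mul h0))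
    have h3 := ht i' j' (right_ne_zero_of_mul h0)
    unfold weight at hc h3
    rcases h1 with rfl | h1 <;> rcases h2 with rfl | h2
    · exact hne ⟨rfl, rfl⟩
    all_goals omega
  have hdiag : ∀ {n : ℕ} {M : Matrix (Fin m) (Fin m) A}, IsUnip d M → ∀ i : Fin n → Fin m,
      ∏ s, M (i s) (i s) = 1 := fun hM i => Finset.prod_eq_one fun s _ => by
    rw [hM _ _ le_rfl, Matrix.one_apply_eq]
  funext i j
  by_cases hc : c ≤ 2 * weight d i j
  · rw [Tensor.act, Finset.sum_eq_single i, Finset.sum_eq_single j, hdiag hg, hdiag hg.inv,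
      one_mul, one_mul]
    · exact fun j' _ hj => key i j i j' hc fun h => hj h.2
    · exact fun h => absurd (Finset.mem_univ _) h
    · exact fun i' _ hi => Finset.sum_eq_zero fun j' _ => key i j i' j' hc fun h => hi h.1
    · exact fun h => absurd (Finset.mem_univ _) h
  -- Below weight `c / 2` both sides vanish, the left one by `ht'` and the right one by homogeneity.
  · have h1 : Tensor.act g t i j = 0 := by
      by_contra h
      exact hc (ht' i j h)
    have h2 : t i j = 0 := by
      by_contra h
      exact hc (ht i j h).ge
    rw [h1, h2]

end Weights

/-! ### Homogeneous spaces of tensors -/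

section Homogeneous

variable {m : ℕ} {K : Type u} [Field K]

/-- The base change of an element of `GL_m(K)`. -/
abbrev baseChange (A : Type u) [CommRing A] [Algebra K A] (g : GL (Fin m) K) : GL (Fin m) A :=
  Matrix.GeneralLinearGroup.map (algebraMap K A) g

/-- In the basis given by the columns of `g`, with weights `d`, all elements of `U` are homogeneous
of half the weight. -/
def IsPure (w : ℤ) (g : GL (Fin m) K) (d : Fin m → ℤ) (U : Submodule K (TensorSum m K)) : Prop :=
  ∀ u ∈ U, ∀ (ab : ℕ × ℕ) (i : Fin ab.1 → Fin m) (j : Fin ab.2 → Fin m),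
    Tensor.act g⁻¹ (u ab) i j ≠ 0 → 2 * weight d i j = w * ((ab.1 : ℤ) - ab.2)

variable {w : ℤ} {B : GL (Fin m) K} {d : Fin m → ℤ} {U : Submodule K (TensorSum m K)}
  {A : Type u} [CommRing A] [Algebra K A]

theorem act_baseChange_inv_map {a b : ℕ} (t : Tensor m K a b) :
    Tensor.act (baseChange A B)⁻¹ (Tensor.map (algebraMap K A) t) =
      Tensor.map (algebraMap K A) (Tensor.act B⁻¹ t) := by
  rw [Tensor.map_act, map_inv]

/-- Purity survives extension of scalars because zero coordinates stay zero; this is what lets the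
unipotent argument run over `K[ε]`. -/
theorem IsPure.weight_eq (hU : IsPure w B d U) {u : TensorSum m K} (hu : u ∈ U) (ab : ℕ × ℕ)
    (i : Fin ab.1 → Fin m) (j : Fin ab.2 → Fin m)
    (hij : Tensor.act (baseChange A B)⁻¹ (Tensor.map (algebraMap K A) (u ab)) i j ≠ 0) :
    2 * weight d i j = w * ((ab.1 : ℤ) - ab.2) := by
  rw [act_baseChange_inv_map] at hij
  refine hU u hu ab i j fun h => hij ?_
  rw [Tensor.map, h, map_zero]

theorem mem_stabilizer_conj_iff {g : GL (Fin m) A} :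
    baseChange A B * g * (baseChange A B)⁻¹ ∈ stabilizer U A ↔
      ∀ u ∈ U, ∀ ab, Tensor.act g (Tensor.act (baseChange A B)⁻¹
        (Tensor.map (algebraMap K A) (u ab))) =
        Tensor.act (baseChange A B)⁻¹ (Tensor.map (algebraMap K A) (u ab)) := by
  refine forall₂_congr fun u _ => forall_congr' fun ab => ?_
  rw [Tensor.act_mul, Tensor.act_mul]
  constructor
  · intro h
    conv_rhs => rw [← h]
    rw [Tensor.act_inv_act]
  · intro h
    rw [h, Tensor.act_act_inv]

theorem map_mem_midTensors_adaptedFil (hU : IsPure w B d U) {u : TensorSum m K} (hu : u ∈ U)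
    (ab : ℕ × ℕ) :
    Tensor.map (algebraMap K A) (u ab) ∈
      midTensors w (adaptedFil (baseChange A B) d) ab.1 ab.2 :=
  mem_midTensors_of_weight_eq fun i j => hU.weight_eq hu ab i j

theorem act_mem_midTensors {w : ℤ} (g : GL (Fin m) A) {F F' : ℤ → Submodule A (Fin m → A)}
    (hF : ∀ p, F' p = (F p).map (glEquiv g : (Fin m → A) →ₗ[A] (Fin m → A))) {a b : ℕ}
    {t : Tensor m A a b} (ht : t ∈ midTensors w F a b) :
    Tensor.act g t ∈ midTensors w F' a b := by
  unfold midTensors at ht ⊢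
  split_ifs at ht ⊢
  · exact act_mem_tensorFiltration g hF ht
  · rw [Submodule.mem_bot] at ht ⊢
    rw [ht]
    exact map_zero (Tensor.actLin a b g)

theorem translate_mem_flagLocus {h : ℤ → ℕ} {g : GL (Fin m) A} (hg : g ∈ stabilizer U A)
    {F : Flag m h A} (hF : F ∈ flagLocus w h U A) : F.translate g ∈ flagLocus w h U A := by
  intro u hu ab
  rw [← hg u hu ab]
  exact act_mem_midTensors g (fun _ => rfl) (hF u hu ab)

/-- A unipotent element that maps `F` into the locus `U ⊆ F^mid` stabilizes `U`. -/
theorem conj_mem_stabilizer_of_mid (hU : IsPure w B d U) {n : GL (Fin m) A} (hn : IsUnip d n.1)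
    (hmid : ∀ u ∈ U, ∀ ab : ℕ × ℕ, Tensor.map (algebraMap K A) (u ab) ∈
      midTensors w (adaptedFil (baseChange A B * n) d) ab.1 ab.2) :
    baseChange A B * n * (baseChange A B)⁻¹ ∈ stabilizer U A := by
  rw [mem_stabilizer_conj_iff]
  intro u hu ab
  -- The coordinates of `u` in the basis `B * n` are `n⁻¹` applied to those in the basis `B`, and
  -- the middle condition bounds their weights from below.
  have h := act_eq_of_isUnip hn.inv (hU.weight_eq (A := A) hu ab) fun i j hij =>
    le_weight_of_mem_midTensors (hmid u hu ab) i j (by rwa [mul_inv_rev, Tensor.act_mul])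
  conv_lhs => rw [← h]
  rw [Tensor.act_act_inv]

end Homogeneous

/-! ### Adapted bases -/

section Adapted

variable {m : ℕ} {K : Type u} [Field K]

/-- The modular law applied to `F^{p+1} ⊕ F_c^{w-p} = V`, intersected with `F^p`. -/
theorem fil_eq_sup_hodgePiece {w : ℤ} {F Fc : ℤ → Submodule K (Fin m → K)} (hF : Antitone F)
    (hopp : Opposed w F Fc) (p : ℤ) : F p = F (p + 1) ⊔ hodgePiece w F Fc p := by
  have h := (hopp (p + 1)).sup_eq_top
  rw [show w - (p + 1) + 1 = w - p by ring] at h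
  rw [hodgePiece, inf_comm, ← sup_inf_assoc_of_le _ (hF (by omega : p ≤ p + 1)), h, top_inf_eq]

theorem iSup_hodgePiece {w : ℤ} {F Fc : ℤ → Submodule K (Fin m → K)} (hF : Antitone F)
    (htop : ∃ i, F i = ⊤) (hbot : ∃ i, F i = ⊥) (hopp : Opposed w F Fc) :
    ⨆ p, hodgePiece w F Fc p = ⊤ := by
  obtain ⟨i, hi⟩ := htop
  obtain ⟨j, hj⟩ := hbot
  have key : ∀ n : ℕ, F (j - n) ≤ ⨆ p, hodgePiece w F Fc p := by
    intro n
    induction n with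
    | zero => simp [hj]
    | succ n ih =>
      rw [fil_eq_sup_hodgePiece hF hopp]
      refine sup_le ?_ (le_iSup (hodgePiece w F Fc) _)
      rwa [show j - ((n + 1 : ℕ) : ℤ) + 1 = j - n by push_cast; ring]
  rw [eq_top_iff, ← hi]
  exact (hF (by omega : j - ((j - i).toNat : ℤ) ≤ i)).trans (key _)

/-- The other pieces lie in `F^{p+1} + F_c^{w-p+1}`. If `x = f + c` there lies in `H^{p,w-p}`, then
`c` is in `F^p ∩ F_c^{w-p+1} = 0`, and then `x = f` is in `F^{p+1} ∩ F_c^{w-p} = 0`. -/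
theorem iSupIndep_hodgePiece {w : ℤ} {F Fc : ℤ → Submodule K (Fin m → K)} (hF : Antitone F)
    (hFc : Antitone Fc) (hopp : Opposed w F Fc) : iSupIndep (hodgePiece w F Fc) := by
  intro p
  have h1 : ⨆ q, ⨆ _ : q ≠ p, hodgePiece w F Fc q ≤ F (p + 1) ⊔ Fc (w - p + 1) := by
    refine iSup₂_le fun q hq => ?_
    rcases lt_or_gt_of_ne hq with hq | hq
    · exact (inf_le_right.trans (hFc (by omega))).trans le_sup_right
    · exact (inf_le_left.trans (hF (by omega))).trans le_sup_left
  refine Disjoint.mono_right h1 (Submodule.disjoint_def.2 fun x hx hx' => ?_)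
  obtain ⟨f, hf, c, hc, rfl⟩ := Submodule.mem_sup.1 hx'
  have hc0 : c = 0 := Submodule.disjoint_def.1 (hopp p).disjoint c
    (by simpa using sub_mem hx.1 (hF (by omega : p ≤ p + 1) hf)) hc
  rw [hc0, add_zero] at hx ⊢
  refine Submodule.disjoint_def.1 (hopp (p + 1)).disjoint f hf ?_
  rw [show w - (p + 1) + 1 = w - p by ring]
  exact hx.2

/-- Two opposed filtrations have a common adapted basis. -/
theorem exists_adapted {w : ℤ} {F Fc : ℤ → Submodule K (Fin m → K)} (hF : Antitone F)
    (htop : ∃ i, F i = ⊤) (hbot : ∃ i, F i = ⊥) (hFc : Antitone Fc) (hopp : Opposed w F Fc) :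
    ∃ (B : GL (Fin m) K) (d : Fin m → ℤ), (∀ p, F p = adaptedFil B d p) ∧
      (∀ q, Fc q = adaptedFil B (fun k => w - d k) q) := by
  have hint : DirectSum.IsInternal (hodgePiece w F Fc) :=
    DirectSum.isInternal_submodule_of_iSupIndep_of_iSup_eq_top (iSupIndep_hodgePiece hF hFc hopp)
      (iSup_hodgePiece hF htop hbot hopp)
  let b₀ := hint.collectedBasis fun p => Module.finBasis K (hodgePiece w F Fc p)
  let e := b₀.indexEquiv (Pi.basisFun K (Fin m))
  let b := b₀.reindex e
  let d : Fin m → ℤ := fun k => (e.symm k).1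
  have hb : ∀ k, b k ∈ hodgePiece w F Fc (d k) := fun k => by
    change b₀.reindex e k ∈ _
    rw [Module.Basis.reindex_apply]
    exact hint.collectedBasis_mem _ _
  let B : GL (Fin m) K :=
    { val := (Pi.basisFun K (Fin m)).toMatrix b
      inv := b.toMatrix (Pi.basisFun K (Fin m))
      val_inv := Module.Basis.toMatrix_mul_toMatrix_flip _ _
      inv_val := Module.Basis.toMatrix_mul_toMatrix_flip _ _ }
  have hB : ∀ x, (B⁻¹).1.mulVec x = b.repr x := fun x =>
    Module.Basis.toMatrix_mulVec_repr (Pi.basisFun K (Fin m)) b x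
  -- Cutting the coordinates at degree `p` realizes the decomposition `F^p ⊕ F_c^{w-p+1}`; both
  -- filtrations are then identified by the vanishing of one of the two parts.
  have hsplit : ∀ (p : ℤ) (x : Fin m → K), ∃ x₁ ∈ F p, ∃ x₂ ∈ Fc (w - p + 1), x = x₁ + x₂ ∧
      (∀ k, d k < p → b.repr x₁ k = 0) ∧ (∀ k, p ≤ d k → b.repr x₂ k = 0) := by
    intro p x
    refine ⟨∑ k with p ≤ d k, b.repr x k • b k, ?_, ∑ k with ¬ p ≤ d k, b.repr x k • b k, ?_, ?_,
      ?_, ?_⟩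
    · refine Submodule.sum_mem _ fun k hk => Submodule.smul_mem _ _ ?_
      exact hF (Finset.mem_filter.1 hk).2 (hb k).1
    · refine Submodule.sum_mem _ fun k hk => Submodule.smul_mem _ _ ?_
      have := (Finset.mem_filter.1 hk).2
      exact hFc (by omega) (hb k).2
    · rw [Finset.sum_filter_add_sum_filter_not, b.sum_repr]
    · intro k hk
      rw [map_sum, Finset.sum_apply']
      refine Finset.sum_eq_zero fun l hl => ?_
      have : l ≠ k := by
        rintro rfl
        exact absurd (Finset.mem_filter.1 hl).2 (not_le.2 hk)
      simp [Finsupp.single_eq_of_ne this.symm]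
    · intro k hk
      rw [map_sum, Finset.sum_apply']
      refine Finset.sum_eq_zero fun l hl => ?_
      have : l ≠ k := by
        rintro rfl
        exact (Finset.mem_filter.1 hl).2 hk
      simp [Finsupp.single_eq_of_ne this.symm]
  refine ⟨B, d, fun p => ?_, fun q => ?_⟩
  · ext x
    rw [mem_adaptedFil, hB]
    obtain ⟨x₁, h₁, x₂, h₂, rfl, hx₁, hx₂⟩ := hsplit p x
    constructor
    · intro hx k hk
      have : x₂ = 0 := Submodule.disjoint_def.1 (hopp p).disjoint x₂
        (by simpa using sub_mem hx h₁) h₂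
      rw [this, add_zero, hx₁ k hk]
    · intro hx
      have : x₂ = 0 := b.repr.injective <| by
        ext k
        rcases le_or_gt p (d k) with hk | hk
        · simpa using hx₂ k hk
        · simpa [hx₁ k hk] using hx k hk
      rw [this, add_zero]
      exact h₁
  · ext x
    rw [mem_adaptedFil, hB]
    -- The cut at `p = w - q + 1` is the one whose complementary step is `F_c^q`.
    obtain ⟨x₁, h₁, x₂, h₂, rfl, hx₁, hx₂⟩ := hsplit (w - q + 1) x
    rw [show w - (w - q + 1) + 1 = q by ring] at h₂
    have hd := (hopp (w - q + 1)).disjoint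
    rw [show w - (w - q + 1) + 1 = q by ring] at hd
    constructor
    · intro hx k hk
      have : x₁ = 0 := Submodule.disjoint_def.1 hd x₁ h₁ (by simpa using sub_mem hx h₂)
      rw [this, zero_add, hx₂ k (by omega)]
    · intro hx
      have : x₁ = 0 := b.repr.injective <| by
        ext k
        rcases le_or_gt (w - q + 1) (d k) with hk | hk
        · simpa [hx₂ k hk] using hx k (by omega)
        · simpa using hx₁ k hk
      rw [this, zero_add]
      exact h₂

theorem mem_hodgePiece_iff {w : ℤ} {F Fc : ℤ → Submodule K (Fin m → K)} {B : GL (Fin m) K}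
    {d : Fin m → ℤ} (hF : ∀ p, F p = adaptedFil B d p)
    (hFc : ∀ q, Fc q = adaptedFil B (fun k => w - d k) q) {p : ℤ} {x : Fin m → K} :
    x ∈ hodgePiece w F Fc p ↔ ∀ k, d k ≠ p → (B⁻¹).1.mulVec x k = 0 := by
  rw [hodgePiece, Submodule.mem_inf, hF, hFc, mem_adaptedFil, mem_adaptedFil]
  constructor
  · rintro ⟨h1, h2⟩ k hk
    rcases lt_or_gt_of_ne hk with hk | hk
    · exact h1 k hk
    · exact h2 k (by omega)
  · exact fun h => ⟨fun k hk => h k hk.ne, fun k hk => h k (by omega)⟩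

end Adapted

/-! ### Flags -/

section Flags

variable {m : ℕ} {h : ℤ → ℕ} {K : Type u} [Field K]

theorem Flag.finrank_gr (F : Flag m h K) (p : ℤ) :
    Module.finrank K (F.fil p ⧸ (F.fil (p + 1)).submoduleOf (F.fil p)) = h p := by
  have h1 := F.rank_gr p ⊥
  rw [Module.rankAtStalk_eq_finrank_of_free] at h1
  simpa using h1

theorem Flag.finrank_fil_succ (F : Flag m h K) (p : ℤ) :
    Module.finrank K (F.fil p) = h p + Module.finrank K (F.fil (p + 1)) := by
  rw [← F.finrank_gr p, ← (Submodule.submoduleOfEquivOfLe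
    (F.antitone_fil (by omega : p ≤ p + 1))).finrank_eq]
  exact (Submodule.finrank_quotient_add_finrank _).symm

/-- The type `h` determines all dimensions, by descending induction from a step where both
filtrations vanish. -/
theorem Flag.finrank_fil_eq (F F' : Flag m h K) (p : ℤ) :
    Module.finrank K (F.fil p) = Module.finrank K (F'.fil p) := by
  obtain ⟨j, hj⟩ := F.separated
  obtain ⟨j', hj'⟩ := F'.separated
  have hbot : ∀ q, max j j' ≤ q → Module.finrank K (F.fil q) = Module.finrank K (F'.fil q) := by
    intro q hq
    rw [eq_bot_iff.2 ((F.antitone_fil ((le_max_left _ _).trans hq)).trans hj.le),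
      eq_bot_iff.2 ((F'.antitone_fil ((le_max_right _ _).trans hq)).trans hj'.le)]
  have key : ∀ n : ℕ, ∀ q, max j j' - n ≤ q →
      Module.finrank K (F.fil q) = Module.finrank K (F'.fil q) := by
    intro n
    induction n with
    | zero => simpa using hbot
    | succ n ih =>
      intro q hq
      rw [F.finrank_fil_succ, F'.finrank_fil_succ, ih (q + 1) (by push_cast at hq; omega)]
  exact key (max j j' - p).toNat p (by omega)

theorem Flag.eq_of_fil_le {F F' : Flag m h K} (hle : ∀ p, F.fil p ≤ F'.fil p) : F = F' :=
  Flag.ext (funext fun p => Submodule.eq_of_le_of_finrank_eq (hle p) (F.finrank_fil_eq F' p))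

theorem Flag.translate_one {A : Type u} [CommRing A] (F : Flag m h A) : F.translate 1 = F := by
  refine Flag.ext (funext fun p => ?_)
  ext x
  simp [Flag.mem_translate]

-- Open and closed conditions on flags

attribute [local instance] zariskiGL

theorem continuous_translate (F : Flag m h K) :
    Continuous fun g : GL (Fin m) K => F.translate g :=
  continuous_iff_coinduced_le.2
    (le_iSup (fun F : Flag m h K => TopologicalSpace.coinduced (fun g => F.translate g)
      (zariskiGL m K)) F)

theorem isOpen_flags_iff {N : Set (Flag m h K)} :
    IsOpen N ↔ ∀ F : Flag m h K, IsOpen {g : GL (Fin m) K | F.translate g ∈ N} :=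
  isOpen_iSup_iff.trans (forall_congr' fun _ => isOpen_coinduced)

theorem isClosed_flags_iff {N : Set (Flag m h K)} :
    IsClosed N ↔ ∀ F : Flag m h K, IsClosed {g : GL (Fin m) K | F.translate g ∈ N} :=
  isClosed_iSup_iff.trans (forall_congr' fun _ => isClosed_coinduced)

/-- Being a complement of a fixed subspace is an open condition on translates. -/
theorem isOpen_isCompl_map {P W W' : Submodule K (Fin m → K)} (hW : IsCompl W W')
    (hP : Module.finrank K P = Module.finrank K W) :
    IsOpen {g : GL (Fin m) K |
      IsCompl (P.map (glEquiv g : (Fin m → K) →ₗ[K] (Fin m → K))) W'} := by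
  let e : W ≃ₗ[K] P := LinearEquiv.ofFinrankEq _ _ hP.symm
  let L : (Fin m → K) →ₗ[K] (Fin m → K) := P.subtype ∘ₗ e ∘ₗ W.projectionOnto W' hW
  -- `T g` carries `W` to `g P` through a fixed isomorphism `W ≃ P` and is the identity on `W'`. It
  -- is invertible exactly when `g P` is a complement of `W'`, so the condition is the nonvanishing
  -- of a regular function.
  let T : GL (Fin m) K → Matrix (Fin m) (Fin m) K := fun g =>
    g.1 * LinearMap.toMatrix' L + LinearMap.toMatrix' (W'.projection W hW.symm)
  have hT : ∀ g x, (T g).mulVec x = g.1.mulVec (L x) + W'.projection W hW.symm x := by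
    intro g x
    rw [Matrix.add_mulVec, ← Matrix.mulVec_mulVec, LinearMap.toMatrix'_mulVec,
      LinearMap.toMatrix'_mulVec]
  have hL : ∀ x, L x ∈ P := fun x => (e _).2
  have hset : {g : GL (Fin m) K |
      IsCompl (P.map (glEquiv g : (Fin m → K) →ₗ[K] (Fin m → K))) W'} =
      {g | (T g).det = 0}ᶜ := by
    ext g
    rw [Set.mem_compl_iff, Set.mem_ofPred_eq, Set.mem_ofPred_eq, ← ne_eq, ← isUnit_iff_ne_zero,
      ← Matrix.isUnit_iff_isUnit_det]
    constructor
    · intro hg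
      rw [← Matrix.mulVec_injective_iff_isUnit]
      refine (injective_iff_map_eq_zero (T g).mulVecLin).2 fun x hx => ?_
      rw [Matrix.mulVecLin_apply, hT] at hx
      have h1 : g.1.mulVec (L x) ∈ W' := by
        rw [eq_neg_of_add_eq_zero_left hx]
        exact neg_mem (Submodule.projection_apply_mem _ _)
      have h2 := Submodule.disjoint_def.1 hg.disjoint _ ⟨L x, hL x, rfl⟩ h1
      have h3 : L x = 0 := (glEquiv g).map_eq_zero_iff.1 h2
      change g.1.mulVec (L x) = 0 at h2
      rw [h2, zero_add, Submodule.projection_apply_eq_zero_iff] at hx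
      have h4 : W.projectionOnto W' hW x = 0 :=
        e.map_eq_zero_iff.1 (Subtype.ext h3)
      rw [Submodule.projectionOnto_apply_eq_zero_iff] at h4
      exact Submodule.disjoint_def.1 hW.disjoint x hx h4
    · intro hg
      have hinj := Matrix.mulVec_injective_iff_isUnit.2 hg
      have hsurj := Matrix.mulVec_surjective_iff_isUnit.2 hg
      constructor
      · rw [Submodule.disjoint_def]
        rintro _ ⟨y, hy, rfl⟩ hy'
        change g.1.mulVec y ∈ W' at hy'
        change g.1.mulVec y = 0
        have hyL : L (e.symm ⟨y, hy⟩ : Fin m → K) = y := by simp [L]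
        have : (e.symm ⟨y, hy⟩ : Fin m → K) = g.1.mulVec y := by
          refine hinj ?_
          rw [hT, hT, hyL, Submodule.projection_apply_of_mem_right _ (e.symm ⟨y, hy⟩).2,
            Submodule.projection_apply_of_mem_left _ hy', add_zero]
          have : L (g.1.mulVec y) = 0 := by
            simp only [L, LinearMap.comp_apply, Submodule.projectionOnto_apply_of_mem_right hW hy']
            simp
          rw [this, Matrix.mulVec_zero, zero_add]
        rw [← this]
        exact Submodule.disjoint_def.1 hW.disjoint _ (e.symm ⟨y, hy⟩).2 (this ▸ hy')
      · rw [codisjoint_iff, eq_top_iff]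
        intro y _
        obtain ⟨x, rfl⟩ := hsurj y
        rw [hT]
        exact Submodule.add_mem_sup ⟨L x, hL x, rfl⟩ (Submodule.projection_apply_mem _ _)
  rw [hset, isOpen_compl_iff]
  refine isClosed_zeros_of_mem_regularFunctions (matrix_det_mem _ fun k l => ?_)
  exact Subalgebra.add_mem _ (matrix_mul_mem (N := fun _ => LinearMap.toMatrix' L) _
    entry_mem_regularFunctions (fun _ _ => const_mem _ _) k l) (const_mem _ _)

/-- The flags opposed to a given filtration form an open set. -/
theorem isOpen_opposed {w : ℤ} {F : Flag m h K} {Fc : ℤ → Submodule K (Fin m → K)}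
    (hopp : Opposed w F.fil Fc) : IsOpen {F' : Flag m h K | Opposed w F'.fil Fc} := by
  rw [isOpen_flags_iff]
  intro F'
  obtain ⟨i, hi⟩ := F.exhaustive
  obtain ⟨j, hj⟩ := F.separated
  obtain ⟨i', hi'⟩ := F'.exhaustive
  obtain ⟨j', hj'⟩ := F'.separated
  -- Only finitely many `p` matter: outside the interval both flags have the same trivial step, `⊤`
  -- or `⊥`, and the condition is already known for `F`.
  have hset : {g : GL (Fin m) K | F'.translate g ∈ {F' : Flag m h K | Opposed w F'.fil Fc}} =
      ⋂ p ∈ Set.Icc (min i i') (max j j'), {g : GL (Fin m) K |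
        IsCompl ((F'.fil p).map (glEquiv g : (Fin m → K) →ₗ[K] (Fin m → K)))
          (Fc (w - p + 1))} := by
    ext g
    simp only [Set.mem_iInter, Set.mem_ofPred_eq]
    refine ⟨fun hg p _ => hg p, fun hg p => ?_⟩
    by_cases hp : p ∈ Set.Icc (min i i') (max j j')
    · exact hg p hp
    · change IsCompl ((F'.fil p).map (glEquiv g : (Fin m → K) →ₗ[K] (Fin m → K))) _
      rw [Set.mem_Icc, not_and_or, not_le, not_le] at hp
      have h1 := hopp p
      rcases hp with hp | hp
      · rw [eq_top_iff.2 (hi.ge.trans (F.antitone_fil (hp.le.trans (min_le_left _ _))))] at h1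
        rw [eq_top_iff.2 (hi'.ge.trans (F'.antitone_fil (hp.le.trans (min_le_right _ _)))),
          Submodule.map_top, LinearEquiv.range]
        exact h1
      · rw [eq_bot_iff.2 ((F.antitone_fil ((le_max_left _ _).trans hp.le)).trans hj.le)] at h1
        rw [eq_bot_iff.2 ((F'.antitone_fil ((le_max_right _ _).trans hp.le)).trans hj'.le),
          Submodule.map_bot]
        exact h1
  rw [hset]
  exact (Set.finite_Icc _ _).isOpen_biInter fun p _ =>
    isOpen_isCompl_map (hopp p) (F'.finrank_fil_eq F p)

theorem map_algebraMap_self {a b : ℕ} (t : Tensor m K a b) :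
    Tensor.map (algebraMap K K) t = t :=
  rfl

theorem tensor_act_mem_regularFunctions {a b : ℕ} (t : Tensor m K a b) (i : Fin a → Fin m)
    (j : Fin b → Fin m) :
    (fun g : GL (Fin m) K => Tensor.act g⁻¹ t i j) ∈ regularFunctions m K := by
  have : (fun g : GL (Fin m) K => Tensor.act g⁻¹ t i j) =
      ∑ i' : Fin a → Fin m, ∑ j' : Fin b → Fin m,
        ((∏ s, fun g : GL (Fin m) K => (g⁻¹).1 (i s) (i' s)) *
          ∏ s, fun g : GL (Fin m) K => g.1 (j' s) (j s)) * fun _ => t i' j' := by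
    funext g
    simp [Tensor.act, Finset.sum_apply, Finset.prod_apply]
  rw [this]
  exact Subalgebra.sum_mem _ fun i' _ => Subalgebra.sum_mem _ fun j' _ => Subalgebra.mul_mem _
    (Subalgebra.mul_mem _ (Subalgebra.prod_mem _ fun s _ => inv_entry_mem_regularFunctions _ _)
      (Subalgebra.prod_mem _ fun s _ => entry_mem_regularFunctions _ _)) (const_mem _ _)

/-- The condition `U ⊆ F'^mid` is closed. -/
theorem isClosed_flagLocus (w : ℤ) (U : Submodule K (TensorSum m K)) :
    IsClosed (flagLocus w h U K) := by
  rw [isClosed_flags_iff]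
  intro F
  -- Moving `g` to the tensor side, `g⁻¹ u` must lie in a fixed subspace, which is cut out by its
  -- annihilator.
  have hset : {g : GL (Fin m) K | F.translate g ∈ flagLocus w h U K} =
      ⋂ u ∈ U, ⋂ ab : ℕ × ℕ, ⋂ ℓ ∈ (midTensors w F.fil ab.1 ab.2).dualAnnihilator,
        {g : GL (Fin m) K | ℓ (Tensor.act g⁻¹ (u ab)) = 0} := by
    ext g
    simp only [Set.mem_iInter, Set.mem_ofPred_eq, flagLocus, map_algebraMap_self]
    refine forall₂_congr fun u _ => forall_congr' fun ab => ?_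
    refine Iff.trans ?_ (Subspace.forall_mem_dualAnnihilator_apply_eq_zero_iff _ _).symm
    constructor
    · refine act_mem_midTensors g⁻¹ fun p => ?_
      ext x
      change _ ↔ _ ∈ ((F.fil p).map _).map _
      rw [mem_map_glEquiv, mem_map_glEquiv, inv_inv, inv_mulVec_mulVec]
    · intro hu
      have := act_mem_midTensors g (F' := (F.translate g).fil) (fun _ => rfl) hu
      rwa [Tensor.act_act_inv] at this
  rw [hset]
  refine isClosed_biInter fun u _ => isClosed_iInter fun ab => isClosed_biInter fun ℓ _ =>
    isClosed_zeros_of_mem_regularFunctions ?_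
  have hℓ : (fun g : GL (Fin m) K => ℓ (Tensor.act g⁻¹ (u ab))) =
      ∑ i, ∑ j, (fun g : GL (Fin m) K => Tensor.act g⁻¹ (u ab) i j) *
        fun _ => ℓ (Pi.single i (Pi.single j 1)) := by
    funext g
    have ht : ∀ t : Tensor m K ab.1 ab.2,
        t = ∑ i, ∑ j, t i j • (Pi.single i (Pi.single j 1) : Tensor m K ab.1 ab.2) := by
      intro t
      funext i j
      simp [Finset.sum_apply, Pi.single_apply, ite_apply]
    conv_lhs => rw [ht (Tensor.act g⁻¹ (u ab))]
    simp [Finset.sum_apply]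
  rw [hℓ]
  exact Subalgebra.sum_mem _ fun i _ => Subalgebra.sum_mem _ fun j _ =>
    Subalgebra.mul_mem _ (tensor_act_mem_regularFunctions _ _ _) (const_mem _ _)

end Flags

/-! ### Diagonal matrices and cocharacters -/

section Diagonal

variable {m : ℕ} {A : Type u} [CommRing A] {a b : ℕ}

/-- The diagonal matrix with entries `z ^ (e k)`. -/
def diagGL (z : Aˣ) (e : Fin m → ℤ) : GL (Fin m) A where
  val := Matrix.diagonal fun k => ((z ^ e k : Aˣ) : A)
  inv := Matrix.diagonal fun k => ((z ^ (-e k) : Aˣ) : A)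
  val_inv := by simp [Matrix.diagonal_mul_diagonal]
  inv_val := by simp [Matrix.diagonal_mul_diagonal]

theorem diagGL_val (z : Aˣ) (e : Fin m → ℤ) :
    (diagGL z e).1 = Matrix.diagonal fun k => ((z ^ e k : Aˣ) : A) :=
  rfl

theorem diagGL_inv_val (z : Aˣ) (e : Fin m → ℤ) :
    ((diagGL z e)⁻¹).1 = Matrix.diagonal fun k => ((z ^ (-e k) : Aˣ) : A) :=
  rfl

theorem diagGL_one (e : Fin m → ℤ) : diagGL (1 : Aˣ) e = 1 :=
  Units.ext (by simp [diagGL_val])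

theorem diagGL_mul (z z' : Aˣ) (e : Fin m → ℤ) : diagGL (z * z') e = diagGL z e * diagGL z' e :=
  Units.ext (by simp [diagGL_val, Matrix.diagonal_mul_diagonal, mul_zpow])

theorem prod_diagonal_zpow (z : Aˣ) (e : Fin m → ℤ) {n : ℕ} (i i' : Fin n → Fin m) :
    ∏ s, Matrix.diagonal (fun k => ((z ^ e k : Aˣ) : A)) (i s) (i' s) =
      if i = i' then ((z ^ (∑ s, e (i s)) : Aˣ) : A) else 0 := by
  split_ifs with h
  · subst h
    have hz : ∀ S : Finset (Fin n), ∏ s ∈ S, z ^ e (i s) = z ^ ∑ s ∈ S, e (i s) := by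
      intro S
      induction S using Finset.induction_on with
      | empty => simp
      | insert s S hs ih => rw [Finset.prod_insert hs, Finset.sum_insert hs, ih, zpow_add]
    simp only [Matrix.diagonal_apply_eq]
    rw [← Units.coe_prod, hz]
  · obtain ⟨s, hs⟩ := Function.ne_iff.1 h
    exact Finset.prod_eq_zero (Finset.mem_univ s) (Matrix.diagonal_apply_ne _ hs)

theorem act_diagGL (z : Aˣ) (e : Fin m → ℤ) (t : Tensor m A a b) (i : Fin a → Fin m)
    (j : Fin b → Fin m) :
    Tensor.act (diagGL z e) t i j = ((z ^ weight e i j : Aˣ) : A) * t i j := by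
  have hneg : ∀ j : Fin b → Fin m, ∑ s, -e (j s) = -∑ s, e (j s) := fun j =>
    Finset.sum_neg_distrib _
  simp only [Tensor.act, diagGL_val, diagGL_inv_val]
  simp only [prod_diagonal_zpow z e, prod_diagonal_zpow z fun k => -e k, hneg]
  rw [Finset.sum_eq_single i, Finset.sum_eq_single j]
  · simp only [if_true]
    rw [← Units.val_mul, ← zpow_add, ← sub_eq_add_neg]
    rfl
  · intro j' _ hj
    rw [if_neg hj, mul_zero, zero_mul]
  · exact fun h => absurd (Finset.mem_univ _) h
  · intro i' _ hi
    refine Finset.sum_eq_zero fun j' _ => ?_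
    rw [if_neg (Ne.symm hi), zero_mul, zero_mul]
  · exact fun h => absurd (Finset.mem_univ _) h

theorem act_diagGL_of_weight_eq (z : Aˣ) {e : Fin m → ℤ} {t : Tensor m A a b} {c : ℤ}
    (ht : ∀ i j, t i j ≠ 0 → weight e i j = c) : Tensor.act (diagGL z e) t = (z ^ c) • t := by
  funext i j
  rw [act_diagGL, Pi.smul_apply, Pi.smul_apply, Units.smul_def, smul_eq_mul]
  by_cases h : t i j = 0
  · rw [h, mul_zero, mul_zero]
  · rw [ht i j h]

/-- An element that scales `t` by a unit normalizes the fixer of `t`; it need not fix `t` itself. -/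
theorem act_conj_eq {D g : GL (Fin m) A} {t : Tensor m A a b} {s : Aˣ}
    (hD : Tensor.act D t = s • t) (hg : Tensor.act g t = t) :
    Tensor.act (D * g * D⁻¹) t = t := by
  have h1 : Tensor.act (D * g * D⁻¹) (Tensor.act D t) = Tensor.act D t := by
    rw [← Tensor.act_mul, inv_mul_cancel_right, Tensor.act_mul, hg]
  rw [hD, Units.smul_def, Tensor.act_smul, ← Units.smul_def, ← Units.smul_def] at h1
  exact smul_left_cancel s h1

/-- All the cocharacters in question have exponents of the form `r * d k + s`, with `(r, s)` equal
to `(1, -w/2)`, `(1, 0)` or `(2, -w)`. -/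
theorem weight_affine (r s : ℤ) (d : Fin m → ℤ) (i : Fin a → Fin m) (j : Fin b → Fin m) :
    weight (fun k => r * d k + s) i j = r * weight d i j + s * ((a : ℤ) - b) := by
  simp only [weight, Finset.sum_add_distrib, Finset.sum_const, Finset.card_univ, Fintype.card_fin,
    nsmul_eq_mul, ← Finset.mul_sum]
  ring

theorem map_diagGL {A' : Type u} [CommRing A'] (f : A →+* A') (z : Aˣ) (e : Fin m → ℤ) :
    Matrix.GeneralLinearGroup.map f (diagGL z e) = diagGL (Units.map (f : A →* A') z) e := by
  refine Units.ext ?_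
  ext k l
  rw [Matrix.GeneralLinearGroup.map_apply]
  by_cases hkl : k = l
  · subst hkl
    simp only [diagGL_val, Matrix.diagonal_apply_eq, ← map_zpow, Units.coe_map]
    rfl
  · simp only [diagGL_val, Matrix.diagonal_apply_ne _ hkl, map_zero]

end Diagonal

/-! ### Cocharacters diagonal in the adapted basis -/

section Cocharacters

variable {m : ℕ} {K : Type u} [Field K] {w : ℤ} {B : GL (Fin m) K} {d : Fin m → ℤ}
  {U : Submodule K (TensorSum m K)}

theorem map_baseChange {A A' : Type u} [CommRing A] [Algebra K A] [CommRing A'] [Algebra K A']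
    (f : A →ₐ[K] A') (B : GL (Fin m) K) :
    Matrix.GeneralLinearGroup.map (f : A →+* A') (baseChange A B) = baseChange A' B := by
  refine Units.ext ?_
  ext k l
  exact f.commutes _

/-- The cocharacter acting on the `k`-th column of `B` as `z ^ (e k)`. -/
def adaptedCocharacter (B : GL (Fin m) K) (e : Fin m → ℤ) : Cocharacter K m where
  hom A _ _ :=
    { toFun := fun z => baseChange A B * diagGL z e * (baseChange A B)⁻¹
      map_one' := by rw [diagGL_one, mul_one, mul_inv_cancel]
      map_mul' := fun z z' => by rw [diagGL_mul]; group }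
  natural A A' _ _ _ _ f z := by
    change baseChange A' B * diagGL _ e * (baseChange A' B)⁻¹ =
      Matrix.GeneralLinearGroup.map (f : A →+* A')
        (baseChange A B * diagGL z e * (baseChange A B)⁻¹)
    rw [map_mul, map_mul, map_inv, map_baseChange, map_diagGL]
    rfl

theorem adaptedCocharacter_hom (e : Fin m → ℤ) (A : Type u) [CommRing A] [Algebra K A] (z : Aˣ) :
    (adaptedCocharacter B e).hom A z = baseChange A B * diagGL z e * (baseChange A B)⁻¹ :=
  rfl

theorem baseChange_inv_mulVec (A : Type u) [CommRing A] [Algebra K A] (B : GL (Fin m) K)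
    (x : Fin m → K) :
    ((baseChange A B)⁻¹).1.mulVec (fun i => algebraMap K A (x i)) =
      fun i => algebraMap K A ((B⁻¹).1.mulVec x i) := by
  rw [← map_inv]
  funext i
  exact (RingHom.map_mulVec (algebraMap K A) (B⁻¹).1 x i).symm

theorem adaptedCocharacter_actsBy {H : ℤ → Submodule K (Fin m → K)}
    (hH : ∀ p x, x ∈ H p ↔ ∀ k, d k ≠ p → (B⁻¹).1.mulVec x k = 0) (e : ℤ → ℤ) :
    (adaptedCocharacter B fun k => e (d k)).ActsBy H e := by
  intro A _ _ z p x hx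
  rw [adaptedCocharacter_hom, Units.val_mul, Units.val_mul, ← Matrix.mulVec_mulVec,
    ← Matrix.mulVec_mulVec, baseChange_inv_mulVec]
  have h1 : (diagGL z fun k => e (d k)).1.mulVec
      (fun i => algebraMap K A ((B⁻¹).1.mulVec x i)) =
      ((z ^ e p : Aˣ) : A) • fun i => algebraMap K A ((B⁻¹).1.mulVec x i) := by
    funext k
    rw [diagGL_val, Matrix.mulVec_diagonal, Pi.smul_apply, smul_eq_mul]
    by_cases hk : d k = p
    · rw [hk]
    · rw [(hH p x).1 hx k hk, map_zero, mul_zero, mul_zero]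
  rw [h1, Matrix.mulVec_smul, ← baseChange_inv_mulVec, mulVec_inv_mulVec]

theorem IsPure.weight_affine_eq (hU : IsPure w B d U) (r s c : ℤ) {A : Type u} [CommRing A]
    [Algebra K A] {u : TensorSum m K} (hu : u ∈ U) (ab : ℕ × ℕ)
    (hc : ∀ n : ℤ, 2 * n = w * ((ab.1 : ℤ) - ab.2) → r * n + s * ((ab.1 : ℤ) - ab.2) = c)
    (z : Aˣ) :
    Tensor.act (diagGL z fun k => r * d k + s)
        (Tensor.act (baseChange A B)⁻¹ (Tensor.map (algebraMap K A) (u ab))) =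
      (z ^ c) • Tensor.act (baseChange A B)⁻¹ (Tensor.map (algebraMap K A) (u ab)) :=
  act_diagGL_of_weight_eq z fun i j hij => by
    rw [weight_affine]
    exact hc _ (hU.weight_eq hu ab i j hij)

theorem adaptedCocharacter_normalizes (hU : IsPure w B d U) (r s : ℤ) :
    (adaptedCocharacter B fun k => r * d k + s).Normalizes U := by
  intro A _ _ z g hg
  rw [adaptedCocharacter_hom]
  have h1 : g = baseChange A B * ((baseChange A B)⁻¹ * g * baseChange A B) *
      (baseChange A B)⁻¹ := by group
  rw [h1, mem_stabilizer_conj_iff] at hg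
  have h2 : ∀ D : GL (Fin m) A, baseChange A B * D * (baseChange A B)⁻¹ * g *
      (baseChange A B * D * (baseChange A B)⁻¹)⁻¹ =
      baseChange A B * (D * ((baseChange A B)⁻¹ * g * baseChange A B) * D⁻¹) *
        (baseChange A B)⁻¹ := fun D => by group
  rw [h2, mem_stabilizer_conj_iff]
  -- The integer division is harmless: the exponent is compared only with integers `n` such that `2
  -- * n` is the total weight, and then the quotient is `n`.
  exact fun u hu ab => act_conj_eq (hU.weight_affine_eq r s
    (r * (w * ((ab.1 : ℤ) - ab.2) / 2) + s * ((ab.1 : ℤ) - ab.2)) hu ab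
    (fun n hn => by rw [← hn, Int.mul_ediv_cancel_left _ two_ne_zero]) z) (hg u hu ab)

/-- The condition says that `r * d + s` vanishes at `d = w/2`, so pure tensors acquire exponent
zero. -/
theorem adaptedCocharacter_factorsThrough (hU : IsPure w B d U) {r s : ℤ} (hrs : 2 * s = -r * w) :
    (adaptedCocharacter B fun k => r * d k + s).FactorsThrough U := by
  intro A _ _ z
  rw [adaptedCocharacter_hom, mem_stabilizer_conj_iff]
  intro u hu ab
  rw [hU.weight_affine_eq r s 0 hu ab _ z, zpow_zero, one_smul]
  intro n hn
  have : 2 * (r * n + s * ((ab.1 : ℤ) - ab.2)) = 0 := by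
    linear_combination r * hn + ((ab.1 : ℤ) - ab.2) * hrs
  omega

end Cocharacters

/-! ### The irreducible component through `F` -/

section Component

variable {m : ℕ} {h : ℤ → ℕ} {K : Type u} [Field K] {w : ℤ} {B : GL (Fin m) K} {d : Fin m → ℤ}
  {U : Submodule K (TensorSum m K)}

theorem baseChange_self (B : GL (Fin m) K) : baseChange K B = B :=
  Units.ext (Matrix.ext fun _ _ => rfl)

theorem mulVec_eq_sum_smul_single (M : Matrix (Fin m) (Fin m) K) (y : Fin m → K) :
    M.mulVec y = ∑ l, y l • M.mulVec (Pi.single l 1) := by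
  funext k
  simp [Matrix.mulVec, dotProduct, Finset.sum_apply, mul_comm]

/-- A flag opposed to `Fc` is a translate of `F` under a unipotent element. -/
theorem exists_isUnip_of_opposed {F F' : Flag m h K} {Fc : ℤ → Submodule K (Fin m → K)}
    (hF : ∀ p, F.fil p = adaptedFil B d p)
    (hFc : ∀ q, Fc q = adaptedFil B (fun k => w - d k) q) (hopp : Opposed w F'.fil Fc) :
    ∃ n : GL (Fin m) K, IsUnip d n.1 ∧ F' = F.translate (B * n * B⁻¹) := by
  -- The `l`-th basis vector is projected to `F'^{d l}` along `F_c^{w - d l + 1}`, the span of the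
  -- basis vectors of degree less than `d l`. The vector changes only in lower degrees, so the
  -- matrix of the `y l` is unipotent.
  let y : Fin m → Fin m → K := fun l =>
    (F'.fil (d l)).projection _ (hopp (d l)) (B.1.mulVec (Pi.single l 1))
  let M : Matrix (Fin m) (Fin m) K := Matrix.of fun k l => (B⁻¹).1.mulVec (y l) k
  have hM : IsUnip d M := by
    intro k l hkl
    have h1 : B.1.mulVec (Pi.single l 1) - y l ∈ Fc (w - d l + 1) := by
      rw [← Submodule.projection_apply_eq_zero_iff (hopp (d l)), map_sub, sub_eq_zero]
      exact (Submodule.projection_apply_of_mem_left _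
        (Submodule.projection_apply_mem _ _)).symm
    rw [hFc, mem_adaptedFil] at h1
    have h2 := h1 k (by omega)
    rw [Matrix.mulVec_sub, inv_mulVec_mulVec, Pi.sub_apply, sub_eq_zero] at h2
    change (B⁻¹).1.mulVec (y l) k = _
    rw [← h2, Matrix.one_apply, Pi.single_apply]
  -- Both flags have type `h`, so an inclusion of their steps is enough.
  refine ⟨unipGL hM, hM, (Flag.eq_of_fil_le fun p => ?_).symm⟩
  rintro _ ⟨x, hx, rfl⟩
  change (B * unipGL hM * B⁻¹).1.mulVec x ∈ _
  change x ∈ F.fil p at hx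
  rw [hF, mem_adaptedFil] at hx
  rw [Units.val_mul, ← Matrix.mulVec_mulVec, mulVec_eq_sum_smul_single]
  refine Submodule.sum_mem _ fun l _ => ?_
  rcases lt_or_ge (d l) p with hl | hl
  · rw [hx l hl, zero_smul]
    exact Submodule.zero_mem _
  · refine Submodule.smul_mem _ _ (F'.antitone_fil hl ?_)
    have : (B * unipGL hM).1.mulVec (Pi.single l 1) = y l := by
      rw [Units.val_mul, ← Matrix.mulVec_mulVec, unipGL_val, Matrix.mulVec_single_one]
      exact mulVec_inv_mulVec B (y l)
    rw [this]
    exact Submodule.projection_apply_mem _ _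

/-- The unipotent elements of `G` adapted to the grading lie in the identity component. -/
theorem conj_mem_identityComponent [Infinite K] (hU : IsPure w B d U) {n : GL (Fin m) K}
    (hn : IsUnip d n.1) (hnU : B * n * B⁻¹ ∈ stabilizer U K) :
    B * n * B⁻¹ ∈ identityComponent U := by
  -- For `z ≠ 0` this is the conjugate of `n` by the diagonal matrix with entries `z ^ (-d k)`.
  -- Exponents are positive where `n` can differ from the identity, so the curve extends to `z = 0`
  -- with value `1`. Where `toNat` truncates, the entry is already that of the identity.
  let M : K → Matrix (Fin m) (Fin m) K := fun z =>
    Matrix.of fun k l => z ^ (d l - d k).toNat * n.1 k l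
  have hM : ∀ z, IsUnip d (M z) := fun z k l hkl => by
    change z ^ (d l - d k).toNat * n.1 k l = _
    rw [show (d l - d k).toNat = 0 by omega, pow_zero, one_mul, hn k l hkl]
  have hM1 : unipGL (hM 1) = n := Units.ext (Matrix.ext fun k l => by
    change 1 ^ _ * n.1 k l = _
    rw [one_pow, one_mul])
  have hM0 : unipGL (hM 0) = 1 := Units.ext (Matrix.ext fun k l => by
    rcases le_or_gt (d l) (d k) with hkl | hkl
    · exact hM 0 k l hkl
    · change 0 ^ _ * n.1 k l = (1 : Matrix (Fin m) (Fin m) K) k l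
      rw [zero_pow (by omega), zero_mul, Matrix.one_apply_ne]
      rintro rfl
      exact lt_irrefl _ hkl)
  have hstab : ∀ z, B * unipGL (hM z) * B⁻¹ ∈ (stabilizer U K : Set (GL (Fin m) K)) := by
    intro z
    by_cases hz : z = 0
    · rw [hz, hM0, mul_one, mul_inv_cancel]
      exact one_mem _
    · have hconj : unipGL (hM z) = diagGL (Units.mk0 z hz)⁻¹ d * n *
          (diagGL (Units.mk0 z hz)⁻¹ d)⁻¹ := by
        refine Units.ext (Matrix.ext fun k l => ?_)
        rw [Units.val_mul, Units.val_mul, diagGL_val, diagGL_inv_val, Matrix.mul_diagonal,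
          Matrix.diagonal_mul]
        change z ^ (d l - d k).toNat * n.1 k l = _
        rcases le_or_gt (d k) (d l) with hkl | hkl
        · rw [← zpow_natCast, Int.toNat_of_nonneg (by omega), mul_right_comm, ← Units.val_mul,
            ← zpow_add, inv_zpow', Units.val_zpow_eq_zpow_val, Units.val_mk0]
          congr 2
          ring
        · rw [hn k l hkl.le, Matrix.one_apply_ne (by rintro rfl; exact lt_irrefl _ hkl)]
          simp
      have := adaptedCocharacter_normalizes hU 1 0 K (Units.mk0 z hz)⁻¹ _ hnU
      simp only [adaptedCocharacter_hom, baseChange_self, one_mul, add_zero] at this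
      rw [hconj, SetLike.mem_coe]
      convert this using 1
      change _ = B * diagGL (Units.mk0 z hz)⁻¹ d * B⁻¹ * (B * n * B⁻¹) *
        (B * diagGL (Units.mk0 z hz)⁻¹ d * B⁻¹)⁻¹
      group
  have hcurve := @mem_connectedComponentIn_of_curve m K _ _ (stabilizer U K)
    (fun z => B * unipGL (hM z) * B⁻¹) ?_ hstab 0 (by rw [hM0, mul_one, mul_inv_cancel]) 1
  · simp only [hM1] at hcurve
    exact hcurve
  · intro k l
    refine ⟨∑ s, (∑ s', Polynomial.C (B.1 k s') * (Polynomial.X ^ (d s - d s').toNat *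
      Polynomial.C (n.1 s' s))) * Polynomial.C ((B⁻¹).1 s l), fun z => ?_⟩
    simp only [Units.val_mul, Matrix.mul_apply, unipGL_val, Polynomial.eval_finsetSum,
      Polynomial.eval_mul, Polynomial.eval_C, Polynomial.eval_pow, Polynomial.eval_X]
    rfl

theorem flagOrbit_subset_flagLocus {F : Flag m h K} (hF : F ∈ flagLocus w h U K) :
    flagOrbit U F ⊆ flagLocus w h U K := by
  rintro _ ⟨g, hg, rfl⟩
  exact translate_mem_flagLocus (@connectedComponentIn_subset _ (zariskiGL m K) _ _ g hg) hF

theorem mem_flagOrbit_self (F : Flag m h K) : F ∈ flagOrbit U F :=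
  ⟨1, @mem_connectedComponentIn _ (zariskiGL m K) _ _ (one_mem (stabilizer U K)),
    F.translate_one⟩

attribute [local instance] zariskiGL in
theorem isIrreducible_flagOrbit (F : Flag m h K) : IsIrreducible (flagOrbit U F) :=
  (isIrreducible_connectedComponentIn (stabilizer U K)).image _
    (continuous_translate F).continuousOn

/-- The local heart of the first claim: a flag opposed to `F_c` is a unipotent translate of `F`,
lying in the locus forces the unipotent into `G`, and contraction puts it in the identity component.
-/
theorem opposed_inter_flagLocus_subset [Infinite K] {F : Flag m h K}
    {Fc : ℤ → Submodule K (Fin m → K)} (hF : ∀ p, F.fil p = adaptedFil B d p)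
    (hFc : ∀ q, Fc q = adaptedFil B (fun k => w - d k) q) (hU : IsPure w B d U) :
    {F' : Flag m h K | Opposed w F'.fil Fc} ∩ flagLocus w h U K ⊆ flagOrbit U F := by
  rintro F' ⟨hopp, hF'⟩
  obtain ⟨n, hn, rfl⟩ := exists_isUnip_of_opposed hF hFc hopp
  refine ⟨_, conj_mem_identityComponent hU hn ?_, rfl⟩
  have := conj_mem_stabilizer_of_mid hU (A := K) (n := n) hn fun u hu ab => by
    convert hF' u hu ab using 1
    congr 1
    funext p
    change _ = (F.fil p).map _
    rw [hF, baseChange_self, ← adaptedFil_mul, inv_mul_cancel_right]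
  simpa only [baseChange_self] using this

/-- For an irreducible subset of the locus through `F`, the part opposed to `F_c` is open and
nonempty, hence dense, and it lies in the orbit. So the orbit closure contains every such subset and
is itself one. -/
theorem isFlagLocusComponent_iff [Infinite K] {F : Flag m h K}
    {Fc : ℤ → Submodule K (Fin m → K)} (hF : ∀ p, F.fil p = adaptedFil B d p)
    (hFc : ∀ q, Fc q = adaptedFil B (fun k => w - d k) q) (hU : IsPure w B d U)
    (hopp : Opposed w F.fil Fc) (hFU : F ∈ flagLocus w h U K) (Z : Set (Flag m h K)) :
    (IsFlagLocusComponent w U Z ∧ F ∈ Z) ↔ Z = closure (flagOrbit U F) := by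
  have hirr : IsIrreducible (closure (flagOrbit U F)) := (isIrreducible_flagOrbit F).closure
  have hsub : closure (flagOrbit U F) ⊆ flagLocus w h U K :=
    closure_minimal (flagOrbit_subset_flagLocus hFU) (isClosed_flagLocus w U)
  have hmem : F ∈ closure (flagOrbit U F) := subset_closure (mem_flagOrbit_self F)
  have hle : ∀ S : Set (Flag m h K), IsIrreducible S → S ⊆ flagLocus w h U K → F ∈ S →
      S ⊆ closure (flagOrbit U F) := fun S hS hSU hFS =>
    (subset_closure_inter_of_isPreirreducible_of_isOpen hS.isPreirreducible
      (isOpen_opposed hopp) ⟨F, hFS, hopp⟩).trans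
      (closure_mono fun _ hx => opposed_inter_flagLocus_subset hF hFc hU ⟨hx.2, hSU hx.1⟩)
  constructor
  · rintro ⟨hZ, hFZ⟩
    have h1 := hle Z hZ.1.1 hZ.1.2 hFZ
    exact Set.Subset.antisymm h1 (hZ.2 ⟨hirr, hsub⟩ h1)
  · rintro rfl
    exact ⟨⟨⟨hirr, hsub⟩, fun S hS hle' => hle S hS.1 hS.2 (hle' hmem)⟩, hmem⟩

end Component

/-! ### The grading of the endomorphisms and of the Lie algebra -/

section Grading

variable {m : ℕ} {K : Type u} [Field K] {w : ℤ} {B : GL (Fin m) K} {d : Fin m → ℤ}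
  {U : Submodule K (TensorSum m K)} {H : ℤ → Submodule K (Fin m → K)}

/-- The matrix of an endomorphism in the basis given by the columns of `B`. -/
def coordEquiv (B : GL (Fin m) K) :
    Matrix (Fin m) (Fin m) K ≃ₗ[K] Matrix (Fin m) (Fin m) K where
  toFun ξ := (B⁻¹).1 * ξ * B.1
  map_add' ξ η := by rw [mul_add, add_mul]
  map_smul' c ξ := by simp
  invFun ξ := B.1 * ξ * (B⁻¹).1
  left_inv ξ := by simp [← mul_assoc]
  right_inv ξ := by simp [← mul_assoc]

theorem coordEquiv_apply (ξ : Matrix (Fin m) (Fin m) K) :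
    coordEquiv B ξ = (B⁻¹).1 * ξ * B.1 :=
  rfl

theorem coordEquiv_symm_apply (ξ : Matrix (Fin m) (Fin m) K) :
    (coordEquiv B).symm ξ = B.1 * ξ * (B⁻¹).1 :=
  rfl

theorem coordEquiv_mulVec (ξ : Matrix (Fin m) (Fin m) K) (x : Fin m → K) :
    (coordEquiv B ξ).mulVec ((B⁻¹).1.mulVec x) = (B⁻¹).1.mulVec (ξ.mulVec x) := by
  rw [coordEquiv_apply, ← Matrix.mulVec_mulVec, mulVec_inv_mulVec, Matrix.mulVec_mulVec]

theorem mem_endGraded_iff (hH : ∀ p x, x ∈ H p ↔ ∀ k, d k ≠ p → (B⁻¹).1.mulVec x k = 0) {i : ℤ}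
    {ξ : Matrix (Fin m) (Fin m) K} :
    ξ ∈ endGraded H i ↔ ∀ k l, d l - d k ≠ i → coordEquiv B ξ k l = 0 := by
  constructor
  · intro h k l hkl
    have h1 : B.1.mulVec (Pi.single l 1) ∈ H (d l) := by
      rw [hH]
      intro k' hk'
      rw [inv_mulVec_mulVec, Pi.single_eq_of_ne]
      rintro rfl
      exact hk' rfl
    have h2 := (hH _ _).1 (h _ _ h1) k (by omega)
    rwa [← coordEquiv_mulVec, inv_mulVec_mulVec, Matrix.mulVec_single_one] at h2
  · intro h p x hx
    rw [hH] at hx ⊢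
    intro k hk
    rw [← coordEquiv_mulVec]
    rw [Matrix.mulVec, dotProduct]
    refine Finset.sum_eq_zero fun l _ => ?_
    by_cases hl : d l = p
    · rw [h k l (by omega), zero_mul]
    · rw [hx l hl, mul_zero]

/-- The part of degree `i` of a matrix, where `e_k` has degree `d k`. -/
def gradePart (d : Fin m → ℤ) (i : ℤ) :
    Matrix (Fin m) (Fin m) K →ₗ[K] Matrix (Fin m) (Fin m) K where
  toFun ξ := Matrix.of fun k l => if d l - d k = i then ξ k l else 0
  map_add' ξ η := by
    ext k l
    simp only [Matrix.of_apply, Matrix.add_apply]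
    split_ifs <;> simp
  map_smul' c ξ := by
    ext k l
    simp

theorem gradePart_apply (i : ℤ) (ξ : Matrix (Fin m) (Fin m) K) (k l : Fin m) :
    gradePart d i ξ k l = if d l - d k = i then ξ k l else 0 :=
  rfl

/-- The part of degree `i` of an endomorphism. -/
def endPart (B : GL (Fin m) K) (d : Fin m → ℤ) (i : ℤ) :
    Matrix (Fin m) (Fin m) K →ₗ[K] Matrix (Fin m) (Fin m) K :=
  (coordEquiv B).symm.toLinearMap ∘ₗ gradePart d i ∘ₗ (coordEquiv B).toLinearMap

theorem coordEquiv_endPart (i : ℤ) (ξ : Matrix (Fin m) (Fin m) K) :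
    coordEquiv B (endPart B d i ξ) = gradePart d i (coordEquiv B ξ) :=
  (coordEquiv B).apply_symm_apply _

theorem endPart_mem_endGraded (hH : ∀ p x, x ∈ H p ↔ ∀ k, d k ≠ p → (B⁻¹).1.mulVec x k = 0)
    (i : ℤ) (ξ : Matrix (Fin m) (Fin m) K) : endPart B d i ξ ∈ endGraded H i := by
  rw [mem_endGraded_iff hH]
  intro k l hkl
  rw [coordEquiv_endPart, gradePart_apply, if_neg hkl]

theorem endPart_of_mem (hH : ∀ p x, x ∈ H p ↔ ∀ k, d k ≠ p → (B⁻¹).1.mulVec x k = 0) {i : ℤ}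
    {ξ : Matrix (Fin m) (Fin m) K} (hξ : ξ ∈ endGraded H i) : endPart B d i ξ = ξ := by
  rw [mem_endGraded_iff hH] at hξ
  apply (coordEquiv B).injective
  rw [coordEquiv_endPart]
  ext k l
  rw [gradePart_apply]
  split_ifs with hkl
  · rfl
  · exact (hξ k l hkl).symm

theorem endPart_of_mem_ne (hH : ∀ p x, x ∈ H p ↔ ∀ k, d k ≠ p → (B⁻¹).1.mulVec x k = 0)
    {i j : ℤ} (hij : i ≠ j) {ξ : Matrix (Fin m) (Fin m) K} (hξ : ξ ∈ endGraded H j) :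
    endPart B d i ξ = 0 := by
  rw [mem_endGraded_iff hH] at hξ
  apply (coordEquiv B).injective
  rw [coordEquiv_endPart, map_zero]
  ext k l
  rw [gradePart_apply]
  split_ifs with hkl
  · exact hξ k l (hkl.trans_ne hij)
  · rfl

theorem iSupIndep_endGraded (hH : ∀ p x, x ∈ H p ↔ ∀ k, d k ≠ p → (B⁻¹).1.mulVec x k = 0) :
    iSupIndep (endGraded H) := by
  intro i
  have h1 : ⨆ j, ⨆ _ : j ≠ i, endGraded H j ≤ LinearMap.ker (endPart B d i) :=
    iSup₂_le fun j hj ξ hξ => LinearMap.mem_ker.2 (endPart_of_mem_ne hH hj.symm hξ)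
  refine Disjoint.mono_right h1 (Submodule.disjoint_def.2 fun ξ hξ hξ' => ?_)
  rw [← endPart_of_mem hH hξ]
  exact hξ'

/-- A bound for the degrees that occur in the grading of the endomorphisms. -/
theorem exists_degree_bound (d : Fin m → ℤ) :
    ∃ N : ℕ, ∀ k l, d l - d k ∈ Finset.Icc (-(N : ℤ)) N := by
  refine ⟨∑ k, ∑ l, (d l - d k).natAbs, fun k l => ?_⟩
  have h1 : (d l - d k).natAbs ≤ ∑ l, (d l - d k).natAbs :=
    Finset.single_le_sum (f := fun l => (d l - d k).natAbs) (fun _ _ => Nat.zero_le _)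
      (Finset.mem_univ l)
  have h2 : ∑ l, (d l - d k).natAbs ≤ ∑ k, ∑ l, (d l - d k).natAbs :=
    Finset.single_le_sum (f := fun k => ∑ l, (d l - d k).natAbs) (fun _ _ => Nat.zero_le _)
      (Finset.mem_univ k)
  rw [Finset.mem_Icc]
  omega

theorem sum_endPart {S : Finset ℤ} (hS : ∀ k l, d l - d k ∈ S) (ξ : Matrix (Fin m) (Fin m) K) :
    ∑ i ∈ S, endPart B d i ξ = ξ := by
  apply (coordEquiv B).injective
  rw [map_sum]
  ext k l
  simp only [coordEquiv_endPart, Matrix.sum_apply, gradePart_apply]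
  rw [Finset.sum_ite_eq, if_pos (hS k l)]

theorem iSup_endGraded (hH : ∀ p x, x ∈ H p ↔ ∀ k, d k ≠ p → (B⁻¹).1.mulVec x k = 0) :
    ⨆ i, endGraded H i = ⊤ := by
  rw [eq_top_iff]
  intro ξ _
  obtain ⟨N, hN⟩ := exists_degree_bound d
  rw [← sum_endPart (B := B) hN ξ]
  exact Submodule.sum_mem _ fun i _ =>
    Submodule.mem_iSup_of_mem i (endPart_mem_endGraded hH i ξ)

theorem map_coordEquiv (A : Type u) [CommRing A] [Algebra K A] (ξ : Matrix (Fin m) (Fin m) K) :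
    ξ.map (algebraMap K A) = (baseChange A B).1 * (coordEquiv B ξ).map (algebraMap K A) *
      ((baseChange A B)⁻¹).1 := by
  conv_lhs => rw [← (coordEquiv B).symm_apply_apply ξ, coordEquiv_symm_apply]
  rw [Matrix.map_mul, Matrix.map_mul, ← map_inv]
  rfl

/-- The graded pieces of the endomorphisms are the weight spaces of the adjoint action. -/
theorem endGraded_eq_adWeightSet
    (hH : ∀ p x, x ∈ H p ↔ ∀ k, d k ≠ p → (B⁻¹).1.mulVec x k = 0) (s i : ℤ) :
    (endGraded H i : Set (Matrix (Fin m) (Fin m) K)) =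
      (adaptedCocharacter B fun k => d k + s).adWeightSet (-i) := by
  -- In adapted coordinates `Ad β(z)` multiplies the entry `(k, l)` by `z ^ (d k - d l)`; the shift
  -- `s` cancels.
  have key : ∀ (ξ : Matrix (Fin m) (Fin m) K) (A : Type u) [CommRing A] [Algebra K A] (z : Aˣ),
      ((adaptedCocharacter B fun k => d k + s).hom A z).1 * ξ.map (algebraMap K A) *
        (((adaptedCocharacter B fun k => d k + s).hom A z)⁻¹).1 =
          ((z ^ (-i) : Aˣ) : A) • ξ.map (algebraMap K A) ↔
      ∀ k l, ((z ^ (d k - d l) : Aˣ) : A) * algebraMap K A (coordEquiv B ξ k l) =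
        ((z ^ (-i) : Aˣ) : A) * algebraMap K A (coordEquiv B ξ k l) := by
    intro ξ A _ _ z
    set C := baseChange A B with hC
    set D := diagGL z fun k => d k + s with hD
    set X := (coordEquiv B ξ).map (algebraMap K A) with hX
    have h1 : ((adaptedCocharacter B fun k => d k + s).hom A z).1 * ξ.map (algebraMap K A) *
        (((adaptedCocharacter B fun k => d k + s).hom A z)⁻¹).1 =
        C.1 * (D.1 * X * (D⁻¹).1) * (C⁻¹).1 := by
      rw [adaptedCocharacter_hom, map_coordEquiv (B := B) A ξ, ← hC, ← hD, ← hX, mul_inv_rev,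
        mul_inv_rev, inv_inv, Units.val_mul, Units.val_mul, Units.val_mul, Units.val_mul]
      simp only [mul_assoc, Units.inv_mul_cancel_left]
    have h2 : ((z ^ (-i) : Aˣ) : A) • ξ.map (algebraMap K A) =
        C.1 * (((z ^ (-i) : Aˣ) : A) • X) * (C⁻¹).1 := by
      rw [map_coordEquiv (B := B) A ξ, Matrix.mul_smul, Matrix.smul_mul]
    rw [h1, h2, Units.mul_left_inj, Units.mul_right_inj, ← Matrix.ext_iff]
    refine forall₂_congr fun k l => ?_
    rw [hD, diagGL_val, diagGL_inv_val, Matrix.mul_diagonal, Matrix.diagonal_mul,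
      mul_right_comm, ← Units.val_mul, ← zpow_add, show d k + s + -(d l + s) = d k - d l by ring]
    rfl
  ext ξ
  rw [SetLike.mem_coe, mem_endGraded_iff hH]
  constructor
  · intro h A _ _ z
    rw [key]
    intro k l
    by_cases hkl : d l - d k = i
    · rw [← hkl, neg_sub]
    · rw [h k l hkl, map_zero, mul_zero, mul_zero]
  · intro h k l hkl
    by_contra hne
    -- Test at the universal point `T` of the multiplicative group, where distinct powers are
    -- distinct elements.
    let z : (LaurentPolynomial K)ˣ :=
      ⟨LaurentPolynomial.T 1, LaurentPolynomial.T (-1), by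
        rw [← LaurentPolynomial.T_add, add_neg_cancel, LaurentPolynomial.T_zero], by
        rw [← LaurentPolynomial.T_add, neg_add_cancel, LaurentPolynomial.T_zero]⟩
    have hz : ∀ n : ℤ, ((z ^ n : (LaurentPolynomial K)ˣ) : LaurentPolynomial K) =
        LaurentPolynomial.T n := by
      intro n
      induction n using Int.induction_on with
      | zero => simp
      | succ n ih => rw [zpow_add, zpow_one, Units.val_mul, ih, LaurentPolynomial.T_add]
      | pred n ih =>
        rw [sub_eq_add_neg, zpow_add, zpow_neg_one, Units.val_mul, ih, LaurentPolynomial.T_add]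
        rfl
    have h1 := (key ξ (LaurentPolynomial K) z).1 (h (LaurentPolynomial K) z) k l
    have hu : IsUnit (algebraMap K (LaurentPolynomial K) (coordEquiv B ξ k l)) :=
      (isUnit_iff_ne_zero.2 hne).map _
    have h2 := hu.mul_right_cancel h1
    rw [hz, hz] at h2
    have h3 := congrArg (fun f : LaurentPolynomial K => f.coeff (-i)) h2
    simp only [LaurentPolynomial.T_apply, if_true] at h3
    rw [if_neg (by omega)] at h3
    exact zero_ne_one h3

end Grading

/-! ### The weight decomposition of the Lie algebra -/

section LieAlgebra

open DualNumber

variable {m : ℕ} {K : Type u} [Field K] {w : ℤ} {B : GL (Fin m) K} {d : Fin m → ℤ}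
  {U : Submodule K (TensorSum m K)} {H : ℤ → Submodule K (Fin m → K)}

theorem map_mul_epsMatrix (M ξ : Matrix (Fin m) (Fin m) K) :
    M.map (algebraMap K K[ε]) * epsMatrix ξ = epsMatrix (M * ξ) := by
  ext1 k l
  simp only [Matrix.mul_apply, epsMatrix, Matrix.map_apply]
  change _ = TrivSqZeroExt.inrHom K K _
  rw [map_sum]
  refine Finset.sum_congr rfl fun s _ => ?_
  exact (TrivSqZeroExt.inl_mul_inr (M k s) (ξ s l))

theorem epsMatrix_mul_map (M ξ : Matrix (Fin m) (Fin m) K) :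
    epsMatrix ξ * M.map (algebraMap K K[ε]) = epsMatrix (ξ * M) := by
  ext1 k l
  simp only [Matrix.mul_apply, epsMatrix, Matrix.map_apply]
  change _ = TrivSqZeroExt.inrHom K K _
  rw [map_sum]
  refine Finset.sum_congr rfl fun s _ => ?_
  rw [mul_comm, mul_comm (ξ k s)]
  exact (TrivSqZeroExt.inl_mul_inr (M s l) (ξ k s))

theorem oneAddEps_conj (g : GL (Fin m) K) (ξ : Matrix (Fin m) (Fin m) K) :
    oneAddEps (g.1 * ξ * (g⁻¹).1) =
      baseChange K[ε] g * oneAddEps ξ * (baseChange K[ε] g)⁻¹ := by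
  refine Units.ext ?_
  rw [← map_inv]
  change 1 + epsMatrix _ = g.1.map (algebraMap K K[ε]) * (1 + epsMatrix ξ) *
    (g⁻¹).1.map (algebraMap K K[ε])
  rw [mul_add, add_mul, map_mul_epsMatrix, epsMatrix_mul_map, mul_one, ← Matrix.map_mul,
    ← Units.val_mul, mul_inv_cancel, Units.val_one, Matrix.map_one _ (map_zero _) (map_one _)]

/-- Conjugating `1 + ε ξ` by a constant point of the torus stays in `G(K[ε])`, because the torus
normalizes `G` as a group functor. -/
theorem conj_diag_mem_lieAlgebra (hU : IsPure w B d U) {ξ : Matrix (Fin m) (Fin m) K}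
    (hξ : ξ ∈ lieAlgebra U) (z : Kˣ) :
    ((adaptedCocharacter B d).hom K z).1 * ξ * (((adaptedCocharacter B d).hom K z)⁻¹).1 ∈
      lieAlgebra U := by
  change oneAddEps _ ∈ stabilizer U K[ε]
  rw [oneAddEps_conj]
  have h1 : baseChange K[ε] ((adaptedCocharacter B d).hom K z) =
      (adaptedCocharacter B d).hom K[ε] (Units.map (Algebra.ofId K K[ε] : K →* K[ε]) z) :=
    ((adaptedCocharacter B d).natural K K[ε] (Algebra.ofId K K[ε]) z).symm
  rw [h1]
  have h2 := adaptedCocharacter_normalizes hU 1 0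
  simp only [one_mul, add_zero] at h2
  exact h2 _ _ _ hξ

/-- The Lie algebra of `G` is graded. -/
theorem endPart_mem_lieAlgebra [Infinite K] (hU : IsPure w B d U)
    {ξ : Matrix (Fin m) (Fin m) K} (hξ : ξ ∈ lieAlgebra U) (i : ℤ) :
    endPart B d i ξ ∈ lieAlgebra U := by
  obtain ⟨N, hN⟩ := exists_degree_bound d
  by_cases hi : i ∈ Finset.Icc (-(N : ℤ)) N
  swap
  · have : endPart B d i ξ = 0 := by
      apply (coordEquiv B).injective
      rw [coordEquiv_endPart, map_zero]
      ext k l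
      rw [gradePart_apply, if_neg fun h : d l - d k = i => hi (h ▸ hN k l)]
      rfl
    rw [this]
    exact Submodule.zero_mem _
  rw [← Subspace.forall_mem_dualAnnihilator_apply_eq_zero_iff]
  intro ℓ hℓ
  -- For a functional `ℓ` killing `𝔤`, this is `ℓ (z ^ N • Ad(z) ξ)` as a polynomial in `z`; the
  -- factor `z ^ N` clears the negative exponents. It vanishes at every nonzero `z`, so all
  -- coefficients vanish, and these are the values of `ℓ` on the graded parts of `ξ`.
  let P : Polynomial K := ∑ n ∈ Finset.range (2 * N + 1),
    Polynomial.C (ℓ (endPart B d (N - n) ξ)) * Polynomial.X ^ n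
  have hconj : ∀ z : Kˣ, ∑ n ∈ Finset.range (2 * N + 1),
      ((z : K) ^ n) • endPart B d (N - n) ξ = ((z : K) ^ N) •
        (((adaptedCocharacter B d).hom K z).1 * ξ *
          (((adaptedCocharacter B d).hom K z)⁻¹).1) := by
    intro z
    apply (coordEquiv B).injective
    have h1 : coordEquiv B (((adaptedCocharacter B d).hom K z).1 * ξ *
          (((adaptedCocharacter B d).hom K z)⁻¹).1) =
        (diagGL z d).1 * coordEquiv B ξ * ((diagGL z d)⁻¹).1 := by
      rw [adaptedCocharacter_hom, baseChange_self, coordEquiv_apply, coordEquiv_apply, mul_inv_rev,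
        mul_inv_rev, inv_inv, Units.val_mul, Units.val_mul, Units.val_mul, Units.val_mul]
      simp only [mul_assoc, Units.inv_mul_cancel_left, Units.inv_mul, mul_one]
    rw [map_smul, h1, map_sum]
    ext k l
    rw [Matrix.smul_apply, diagGL_val, diagGL_inv_val, Matrix.mul_diagonal, Matrix.diagonal_mul,
      Matrix.sum_apply]
    have h2 := Finset.mem_Icc.1 (hN k l)
    rw [Finset.sum_eq_single (N - (d l - d k)).toNat]
    · rw [map_smul, coordEquiv_endPart, Matrix.smul_apply, gradePart_apply, if_pos (by omega),
        mul_right_comm, ← Units.val_mul, ← zpow_add, smul_eq_mul, smul_eq_mul, ← mul_assoc,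
        Units.val_zpow_eq_zpow_val, ← zpow_natCast, ← zpow_natCast, ← zpow_add₀ z.ne_zero]
      congr 2
      omega
    · intro n _ hn
      rw [map_smul, coordEquiv_endPart, Matrix.smul_apply, gradePart_apply, if_neg (by omega),
        smul_zero]
    · intro h
      exact absurd (Finset.mem_range.2 (by omega)) h
  have hroot : ∀ z : Kˣ, P.eval (z : K) = 0 := by
    intro z
    have h1 := congrArg ℓ (hconj z)
    rw [map_smul, (Submodule.mem_dualAnnihilator ℓ).1 hℓ _ (conj_diag_mem_lieAlgebra hU hξ z),
      smul_zero, map_sum] at h1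
    rw [← h1, Polynomial.eval_finsetSum]
    refine Finset.sum_congr rfl fun n _ => ?_
    rw [map_smul, Polynomial.eval_mul, Polynomial.eval_C, Polynomial.eval_pow, Polynomial.eval_X,
      smul_eq_mul, mul_comm]
  have hP : P = 0 := by
    refine Polynomial.eq_zero_of_infinite_isRoot P (Set.Infinite.mono (s := {0}ᶜ) (fun z hz => ?_)
      (Set.finite_singleton 0).infinite_compl)
    exact hroot (Units.mk0 z hz)
  rw [Finset.mem_Icc] at hi
  have hc : P.coeff (N - i).toNat = ℓ (endPart B d i ξ) := by
    simp only [P, Polynomial.finsetSum_coeff, Polynomial.coeff_C_mul, Polynomial.coeff_X_pow]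
    rw [Finset.sum_eq_single (N - i).toNat]
    · rw [if_pos rfl, mul_one, show (N : ℤ) - ((N - i).toNat : ℤ) = i by omega]
    · intro n _ hn
      rw [if_neg hn.symm, mul_zero]
    · intro h
      exact absurd (Finset.mem_range.2 (by omega)) h
  rw [← hc, hP, Polynomial.coeff_zero]

theorem iSup_lieAlgebra_inf_endGraded [Infinite K] (hU : IsPure w B d U)
    (hH : ∀ p x, x ∈ H p ↔ ∀ k, d k ≠ p → (B⁻¹).1.mulVec x k = 0) :
    ⨆ i : ℤ, lieAlgebra U ⊓ endGraded H i = lieAlgebra U := by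
  refine le_antisymm (iSup_le fun i => inf_le_left) fun ξ hξ => ?_
  obtain ⟨N, hN⟩ := exists_degree_bound d
  rw [← sum_endPart (B := B) hN ξ]
  exact Submodule.sum_mem _ fun i _ => Submodule.mem_iSup_of_mem i
    ⟨endPart_mem_lieAlgebra hU hξ i, endPart_mem_endGraded hH i ξ⟩

/-- The positive part of the Lie algebra consists of its strictly triangular elements. -/
theorem mem_iSup_pos_iff [Infinite K] (hU : IsPure w B d U)
    (hH : ∀ p x, x ∈ H p ↔ ∀ k, d k ≠ p → (B⁻¹).1.mulVec x k = 0)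
    {ξ : Matrix (Fin m) (Fin m) K} :
    ξ ∈ (⨆ i : ℤ, ⨆ _ : 0 < i, lieAlgebra U ⊓ endGraded H i) ↔
      ξ ∈ lieAlgebra U ∧ ∀ k l, d l ≤ d k → coordEquiv B ξ k l = 0 := by
  constructor
  · intro h
    refine ⟨(iSup₂_le fun i _ => inf_le_left :
      (⨆ i : ℤ, ⨆ _ : 0 < i, lieAlgebra U ⊓ endGraded H i) ≤ lieAlgebra U) h,
      fun k l hkl => ?_⟩
    let E : Matrix (Fin m) (Fin m) K →ₗ[K] K :=
      Matrix.entryLinearMap K K k l ∘ₗ (coordEquiv B).toLinearMap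
    have hE : (⨆ i : ℤ, ⨆ _ : 0 < i, lieAlgebra U ⊓ endGraded H i) ≤ LinearMap.ker E :=
      iSup₂_le fun i hi η hη => LinearMap.mem_ker.2
        ((mem_endGraded_iff hH).1 hη.2 k l (by omega))
    exact hE h
  · rintro ⟨hξ, hpos⟩
    obtain ⟨N, hN⟩ := exists_degree_bound d
    rw [← sum_endPart (B := B) hN ξ]
    refine Submodule.sum_mem _ fun i _ => ?_
    rcases lt_or_ge 0 i with hi | hi
    · exact Submodule.mem_iSup_of_mem i (Submodule.mem_iSup_of_mem hi
        ⟨endPart_mem_lieAlgebra hU hξ i, endPart_mem_endGraded hH i ξ⟩)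
    · have : endPart B d i ξ = 0 := by
        apply (coordEquiv B).injective
        rw [coordEquiv_endPart, map_zero]
        ext k l
        rw [gradePart_apply]
        split_ifs with hkl
        · exact hpos k l (by omega)
        · rfl
      rw [this]
      exact Submodule.zero_mem _

end LieAlgebra

/-! ### Standard flags -/

section StdFlag

variable {m : ℕ} {h : ℤ → ℕ}

/-- The graded pieces of the filtration `stdFil`. -/
def stdFilGrEquiv (A : Type u) [CommRing A] (d : Fin m → ℤ) (p : ℤ) :
    (stdFil A d p ⧸ (stdFil A d (p + 1)).submoduleOf (stdFil A d p)) ≃ₗ[A]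
      ({k // d k = p} → A) :=
  let f : stdFil A d p →ₗ[A] ({k // d k = p} → A) :=
    LinearMap.funLeft A A Subtype.val ∘ₗ (stdFil A d p).subtype
  (Submodule.quotEquivOfEq _ (LinearMap.ker f) (by
    ext x
    rw [Submodule.submoduleOf, Submodule.mem_comap, LinearMap.mem_ker]
    constructor
    · intro hx
      funext k
      exact hx k.1 (by have := k.2; omega)
    · intro hx k hk
      rcases lt_or_ge (d k) p with hkp | hkp
      · exact x.2 k hkp
      · exact congrFun hx ⟨k, by omega⟩)).trans
  (f.quotKerEquivOfSurjective fun y => by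
    classical
    refine ⟨⟨fun k => if hk : d k = p then y ⟨k, hk⟩ else 0, fun k hk => dif_neg hk.ne⟩, ?_⟩
    funext k
    exact dif_pos k.2)

/-- The flag for which the basis vector `e_k` has degree `d k`. -/
def stdFlag (A : Type u) [CommRing A] [Nontrivial A] (d : Fin m → ℤ)
    (hd : ∀ i, Fintype.card {k // d k = i} = h i) : Flag m h A where
  fil := stdFil A d
  antitone_fil _ _ hpq _ hx k hk := hx k (hk.trans_le hpq)
  exhaustive := by
    obtain ⟨i, hi⟩ := (Set.finite_range d).bddBelow
    refine ⟨i, eq_top_iff.2 fun x _ k hk => ?_⟩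
    exact absurd (hi (Set.mem_range_self k)) (not_le.2 hk)
  separated := by
    obtain ⟨i, hi⟩ := (Set.finite_range d).bddAbove
    refine ⟨i + 1, eq_bot_iff.2 fun x hx => (Submodule.mem_bot A).2 (funext fun k => ?_)⟩
    exact hx k (Int.lt_add_one_of_le (hi (Set.mem_range_self k)))
  finite_gr i := Module.Finite.equiv (stdFilGrEquiv A d i).symm
  projective_gr i := Module.Projective.of_equiv (stdFilGrEquiv A d i).symm
  rank_gr i 𝔭 := by
    rw [Module.rankAtStalk_eq_of_equiv (stdFilGrEquiv A d i),
      Module.rankAtStalk_eq_finrank_of_free, Pi.natCast_apply, Module.finrank_fintype_fun_eq_card,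
      hd, Nat.cast_id]

/-- This makes the standard flag over `K[ε]` a flag of type `h`, so that `F` can be extended to a
constant flag over the dual numbers. -/
theorem card_eq_of_adapted {K : Type u} [Field K] {F : Flag m h K} {B : GL (Fin m) K}
    {d : Fin m → ℤ} (hF : ∀ p, F.fil p = adaptedFil B d p) (i : ℤ) :
    Fintype.card {k // d k = i} = h i := by
  have h1 := F.finrank_gr i
  -- Stated for arbitrary submodules so that the equalities can be substituted inside the dependent
  -- quotient.
  have h2 : ∀ P P' : Submodule K (Fin m → K), F.fil i = P → F.fil (i + 1) = P' →
      Module.finrank K (P ⧸ P'.submoduleOf P) = h i := by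
    rintro _ _ rfl rfl
    exact h1
  rw [← h2 _ _ (hF i) (hF (i + 1)), ← Module.finrank_fintype_fun_eq_card K (η := {k // d k = i}),
    ← (stdFilGrEquiv K d i).finrank_eq, (grMapEquiv (glEquiv B) _ _).finrank_eq]
  rfl

end StdFlag

/-! ### The tangent space -/

section Tangent

open DualNumber

variable {m : ℕ} {h : ℤ → ℕ} {K : Type u} [Field K] {w : ℤ} {B : GL (Fin m) K} {d : Fin m → ℤ}
  {U : Submodule K (TensorSum m K)}

theorem fst_sum {ι : Type*} (s : Finset ι) (f : ι → K[ε]) :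
    (∑ i ∈ s, f i).fst = ∑ i ∈ s, (f i).fst :=
  map_sum (TrivSqZeroExt.fstHom K K K) f s

theorem snd_sum {ι : Type*} (s : Finset ι) (f : ι → K[ε]) :
    (∑ i ∈ s, f i).snd = ∑ i ∈ s, (f i).snd :=
  map_sum (TrivSqZeroExt.sndHom K K) f s

theorem fst_baseChange_mulVec (g : GL (Fin m) K) (v : Fin m → K[ε]) (k : Fin m) :
    ((baseChange K[ε] g).1.mulVec v k).fst = g.1.mulVec (fun i => (v i).fst) k := by
  rw [Matrix.mulVec, dotProduct, fst_sum]
  refine Finset.sum_congr rfl fun l _ => ?_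
  rw [TrivSqZeroExt.fst_mul]
  rfl

theorem snd_baseChange_mulVec (g : GL (Fin m) K) (v : Fin m → K[ε]) (k : Fin m) :
    ((baseChange K[ε] g).1.mulVec v k).snd = g.1.mulVec (fun i => (v i).snd) k := by
  rw [Matrix.mulVec, dotProduct, snd_sum]
  refine Finset.sum_congr rfl fun l _ => ?_
  rw [TrivSqZeroExt.snd_mul]
  change g.1 k l • (v l).snd + _ • (0 : K) = _
  rw [smul_zero, add_zero]
  rfl

theorem fst_oneAddEps_mulVec (ξ : Matrix (Fin m) (Fin m) K) (v : Fin m → K[ε]) (k : Fin m) :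
    ((oneAddEps ξ).1.mulVec v k).fst = (v k).fst := by
  change ((1 + epsMatrix ξ).mulVec v k).fst = _
  rw [Matrix.add_mulVec, Matrix.one_mulVec, Pi.add_apply, TrivSqZeroExt.fst_add, Matrix.mulVec,
    dotProduct, fst_sum, Finset.sum_eq_zero, add_zero]
  intro l _
  rw [TrivSqZeroExt.fst_mul]
  exact zero_mul _

theorem snd_oneAddEps_mulVec (ξ : Matrix (Fin m) (Fin m) K) (v : Fin m → K[ε]) (k : Fin m) :
    ((oneAddEps ξ).1.mulVec v k).snd = (v k).snd + ξ.mulVec (fun i => (v i).fst) k := by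
  change ((1 + epsMatrix ξ).mulVec v k).snd = _
  rw [Matrix.add_mulVec, Matrix.one_mulVec, Pi.add_apply, TrivSqZeroExt.snd_add, Matrix.mulVec,
    dotProduct, snd_sum]
  congr 1
  refine Finset.sum_congr rfl fun l _ => ?_
  rw [TrivSqZeroExt.snd_mul]
  change (0 : K) • (v l).snd + MulOpposite.op (v l).fst • ξ k l = ξ k l * (v l).fst
  rw [zero_smul, zero_add, op_smul_eq_mul]

theorem oneAddEps_inv (ξ : Matrix (Fin m) (Fin m) K) : (oneAddEps ξ)⁻¹ = oneAddEps (-ξ) := by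
  rw [inv_eq_iff_mul_eq_one, ← oneAddEps_add, add_neg_cancel, oneAddEps_zero]

/-- Translating the constant flag by `1 + ε ξ` deforms it in the direction of `ξ`. -/
theorem adaptedFil_oneAddEps {F : Flag m h K} (hF : ∀ p, F.fil p = adaptedFil B d p)
    (ξ : Matrix (Fin m) (Fin m) K) (p : ℤ) :
    adaptedFil (oneAddEps ξ * baseChange K[ε] B) d p =
      deformation (F.fil p) (tangentMap F ξ p) := by
  have hmem : ∀ x : Fin m → K, x ∈ F.fil p ↔ ∀ k, d k < p → (B⁻¹).1.mulVec x k = 0 := fun x => by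
    rw [hF, mem_adaptedFil]
  ext v
  -- Since `(1 + ε ξ)⁻¹ = 1 - ε ξ`, the vector `x + ε y` is pulled back to `x + ε (y - ξ x)`, whose
  -- two components are tested separately.
  have h1 : v ∈ adaptedFil (oneAddEps ξ * baseChange K[ε] B) d p ↔
      (fun i => (v i).fst) ∈ F.fil p ∧
        (fun i => (v i).snd) - ξ.mulVec (fun i => (v i).fst) ∈ F.fil p := by
    rw [mem_adaptedFil, hmem, hmem, ← forall₂_and]
    refine forall₂_congr fun k _ => ?_
    rw [mul_inv_rev, Units.val_mul, ← Matrix.mulVec_mulVec, oneAddEps_inv, ← map_inv,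
      TrivSqZeroExt.ext_iff, fst_baseChange_mulVec, snd_baseChange_mulVec]
    have e1 : (fun i => ((oneAddEps (-ξ)).1.mulVec v i).fst) = fun i => (v i).fst :=
      funext fun i => fst_oneAddEps_mulVec _ _ _
    have e2 : (fun i => ((oneAddEps (-ξ)).1.mulVec v i).snd) =
        (fun i => (v i).snd) - ξ.mulVec (fun i => (v i).fst) := funext fun i => by
      rw [snd_oneAddEps_mulVec, Matrix.neg_mulVec, Pi.neg_apply, Pi.sub_apply, sub_eq_add_neg]
    rw [e1, e2]
    rfl
  rw [h1]
  constructor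
  · rintro ⟨hx, hy⟩
    exact ⟨⟨_, hx⟩, fun _ => rfl, (Submodule.Quotient.eq _).2 hy⟩
  · rintro ⟨x, hx, hy⟩
    have hx' : (fun i => (v i).fst) = (x : Fin m → K) := funext hx
    rw [hx']
    exact ⟨x.2, (Submodule.Quotient.eq _).1 hy⟩

theorem coord_oneAddEps (ξ : Matrix (Fin m) (Fin m) K) :
    oneAddEps ξ =
      baseChange K[ε] B * oneAddEps (coordEquiv B ξ) * (baseChange K[ε] B)⁻¹ := by
  rw [← oneAddEps_conj, ← coordEquiv_symm_apply, LinearEquiv.symm_apply_apply]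

theorem isUnip_oneAddEps {ξ : Matrix (Fin m) (Fin m) K} (hξ : ∀ k l, d l ≤ d k → ξ k l = 0) :
    IsUnip d (oneAddEps ξ).1 := by
  intro k l hkl
  change (1 : Matrix (Fin m) (Fin m) K[ε]) k l + TrivSqZeroExt.inr (ξ k l) = _
  rw [hξ k l hkl, TrivSqZeroExt.inr_zero, add_zero]

/-- Every flag over the dual numbers which reduces to `F` is a translate of `F` under `1 + ε ξ`
for a strictly triangular `ξ`. -/
theorem exists_tangentMap_eq {F : Flag m h K} (hF : ∀ p, F.fil p = adaptedFil B d p)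
    {F' : Flag m h K[ε]} {φ : ∀ p : ℤ, F.fil p →ₗ[K] (Fin m → K) ⧸ F.fil p}
    (hF' : ∀ p, F'.fil p = deformation (F.fil p) (φ p)) :
    ∃ ξ : Matrix (Fin m) (Fin m) K, (∀ k l, d l ≤ d k → coordEquiv B ξ k l = 0) ∧
      tangentMap F ξ = φ := by
  have hmem : ∀ p (x : Fin m → K), x ∈ F.fil p ↔ ∀ k, d k < p → (B⁻¹).1.mulVec x k = 0 :=
    fun p x => by rw [hF, mem_adaptedFil]
  have hb : ∀ l, B.1.mulVec (Pi.single l 1) ∈ F.fil (d l) := fun l => by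
    rw [hF]
    exact ⟨_, single_mem_stdFil le_rfl 1, rfl⟩
  choose y hy using fun l => Submodule.Quotient.mk_surjective (F.fil (d l)) (φ (d l) ⟨_, hb l⟩)
  -- Column `l` records a lift of `φ` on the `l`-th basis vector. The entries with `d l ≤ d k` are
  -- dropped, as they only change the lift by an element of `F^{d l}`.
  let X : Matrix (Fin m) (Fin m) K := Matrix.of fun k l =>
    if d k < d l then (B⁻¹).1.mulVec (y l) k else 0
  refine ⟨(coordEquiv B).symm X, fun k l hkl => ?_, ?_⟩
  · rw [LinearEquiv.apply_symm_apply]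
    exact if_neg (not_lt.2 hkl)
  funext p
  ext1 ⟨x, hx⟩
  set c := (B⁻¹).1.mulVec x with hc
  have hxc : x = ∑ l, c l • B.1.mulVec (Pi.single l 1) := by
    rw [← mulVec_eq_sum_smul_single, hc, mulVec_inv_mulVec]
  let v : Fin m → Fin m → K[ε] := fun l i =>
    TrivSqZeroExt.inl (B.1.mulVec (Pi.single l 1) i) + TrivSqZeroExt.inr (y l i)
  have hv : ∀ l, v l ∈ F'.fil (d l) := fun l => by
    rw [hF']
    exact ⟨⟨_, hb l⟩, fun i => by simp [v], by simpa [v] using hy l⟩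
  -- Because `F'` is decreasing, the lifts taken at the various steps `d l` combine inside `F'^p`.
  -- This expresses `φ p` through the values chosen on basis vectors.
  have hsum : ∑ l, (TrivSqZeroExt.inl (c l) : K[ε]) • v l ∈ F'.fil p := by
    refine Submodule.sum_mem _ fun l _ => ?_
    rcases lt_or_ge (d l) p with hl | hl
    · have : c l = 0 := (hmem p x).1 hx l hl
      rw [this, TrivSqZeroExt.inl_zero, zero_smul]
      exact Submodule.zero_mem _
    · exact Submodule.smul_mem _ _ (F'.antitone_fil hl (hv l))
  rw [hF'] at hsum
  obtain ⟨x', hx', hy'⟩ := hsum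
  have hfst : ∀ i, ((∑ l, (TrivSqZeroExt.inl (c l) : K[ε]) • v l) i).fst = x i := fun i => by
    rw [Finset.sum_apply, fst_sum, hxc, Finset.sum_apply]
    refine Finset.sum_congr rfl fun l _ => ?_
    simp [v]
  have hsnd : (fun i => ((∑ l, (TrivSqZeroExt.inl (c l) : K[ε]) • v l) i).snd) =
      ∑ l, c l • y l := by
    funext i
    rw [Finset.sum_apply, snd_sum, Finset.sum_apply]
    refine Finset.sum_congr rfl fun l _ => ?_
    simp [v]
  obtain rfl : x' = ⟨x, hx⟩ := Subtype.ext (funext fun i => (hx' i).symm.trans (hfst i))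
  rw [← hy', hsnd]
  refine (Submodule.Quotient.eq _).2 ((hmem p _).2 fun k hk => ?_)
  change (B⁻¹).1.mulVec (((coordEquiv B).symm X).mulVec x - _) k = 0
  rw [Matrix.mulVec_sub, ← coordEquiv_mulVec, LinearEquiv.apply_symm_apply, Pi.sub_apply,
    sub_eq_zero, Matrix.mulVec_sum, Finset.sum_apply, Matrix.mulVec, dotProduct]
  refine Finset.sum_congr rfl fun l _ => ?_
  rw [Matrix.mulVec_smul, Pi.smul_apply, smul_eq_mul, mul_comm]
  rcases lt_or_ge (d l) p with hl | hl
  · have : c l = 0 := (hmem p x).1 hx l hl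
    rw [this, zero_mul, ← hc, this, zero_mul]
  · congr 1
    exact if_pos (hk.trans_le hl)

/-- The kernel of the tangent map consists of endomorphisms preserving every `F^p`, which have no
entry with `d k < d l`; a strictly triangular one has no other entries. -/
theorem tangentMap_injective {F : Flag m h K} (hF : ∀ p, F.fil p = adaptedFil B d p)
    {ξ : Matrix (Fin m) (Fin m) K} (hξ : ∀ k l, d l ≤ d k → coordEquiv B ξ k l = 0)
    (h0 : tangentMap F ξ = 0) : ξ = 0 := by
  apply (coordEquiv B).injective
  rw [map_zero]
  ext k l
  rcases le_or_gt (d l) (d k) with hkl | hkl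
  · exact hξ k l hkl
  · have hb : B.1.mulVec (Pi.single l 1) ∈ F.fil (d l) := by
      rw [hF]
      exact ⟨_, single_mem_stdFil le_rfl 1, rfl⟩
    have h1 : ξ.mulVec (B.1.mulVec (Pi.single l 1)) ∈ F.fil (d l) :=
      (Submodule.Quotient.mk_eq_zero _).1 (LinearMap.congr_fun (congrFun h0 (d l)) ⟨_, hb⟩)
    rw [hF, mem_adaptedFil] at h1
    have h2 := h1 k hkl
    rwa [← coordEquiv_mulVec, inv_mulVec_mulVec, Matrix.mulVec_single_one] at h2

/-- For `ξ ∈ 𝔤`, translating the constant flag by `1 + ε ξ ∈ G(K[ε])` stays in the locus. Conversely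
a tangent vector comes from a strictly triangular `ξ`; then `1 + ε ξ` is unipotent in adapted
coordinates, and the argument used for `K`-points puts it in `G(K[ε])`. -/
theorem bijOn_tangentMap [Infinite K] {F : Flag m h K} (hF : ∀ p, F.fil p = adaptedFil B d p)
    (hU : IsPure w B d U) {H : ℤ → Submodule K (Fin m → K)}
    (hH : ∀ p x, x ∈ H p ↔ ∀ k, d k ≠ p → (B⁻¹).1.mulVec x k = 0) :
    Set.BijOn (tangentMap F)
      ((⨆ i : ℤ, ⨆ _ : 0 < i, lieAlgebra U ⊓ endGraded H i :
        Submodule K (Matrix (Fin m) (Fin m) K)) : Set (Matrix (Fin m) (Fin m) K))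
      (flagLocusTangent w U F) := by
  refine ⟨fun ξ hξ => ?_, fun ξ hξ η hη hξη => ?_, fun φ hφ => ?_⟩
  · obtain ⟨hξU, -⟩ := (mem_iSup_pos_iff hU hH).1 hξ
    let F₀ : Flag m h K[ε] :=
      (stdFlag K[ε] d (card_eq_of_adapted hF)).translate (baseChange K[ε] B)
    have hF₀ : F₀ ∈ flagLocus w h U K[ε] := fun u hu ab =>
      map_mem_midTensors_adaptedFil hU hu ab
    refine ⟨F₀.translate (oneAddEps ξ), translate_mem_flagLocus hξU hF₀, fun p => ?_⟩
    rw [← adaptedFil_oneAddEps hF, adaptedFil_mul]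
    rfl
  · rw [← sub_eq_zero]
    refine tangentMap_injective hF ((mem_iSup_pos_iff hU hH).1 (Submodule.sub_mem _ hξ hη)).2 ?_
    exact (map_sub _ _ _).trans (sub_eq_zero.2 hξη)
  · obtain ⟨F', hF', hφ⟩ := hφ
    obtain ⟨ξ, hξ, rfl⟩ := exists_tangentMap_eq hF hφ
    refine ⟨ξ, (mem_iSup_pos_iff hU hH).2 ⟨?_, hξ⟩, rfl⟩
    change oneAddEps ξ ∈ stabilizer U K[ε]
    rw [coord_oneAddEps (B := B)]
    refine conj_mem_stabilizer_of_mid hU (isUnip_oneAddEps hξ) fun u hu ab => ?_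
    convert hF' u hu ab using 1
    congr 1
    funext p
    rw [hφ, ← adaptedFil_oneAddEps hF, coord_oneAddEps (B := B) ξ, inv_mul_cancel_right]

end Tangent

end TensorFlag

end

theorem mainTheorem10 {K : Type u} [Field K] [IsAlgClosed K] (hK : ringChar K ≠ 2)
    (m : ℕ) (h : ℤ → ℕ) (w : ℤ)
    -- a polarization
    (Q : LinearMap.BilinForm K (Fin m → K)) (hQ : Q.Nondegenerate) (hQs : Q.IsSymm ∨ Q.IsAlt)
    -- a flag of weight `w` and a filtration opposed to it
    (F : Flag m h K) (Fc : ℤ → Submodule K (Fin m → K)) (hFc : Antitone Fc)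
    (hopp : Opposed w F.fil Fc)
    -- a space of tensors containing `Q` and contained in `F^mid ∩ Fc^mid`
    (U : Submodule K (TensorSum m K)) (hQU : formTensor Q ∈ U)
    (hU : ∀ u ∈ U, ∀ ab : ℕ × ℕ,
      u ab ∈ midTensors w F.fil ab.1 ab.2 ⊓ midTensors w Fc ab.1 ab.2) :
    -- there is a unique irreducible component through `F` of the scheme of flags `F'` with
    -- `U ⊆ F'^mid`, it is the closure of the orbit of `F`, and it contains a neighbourhood of `F`
    (∀ Z : Set (Flag m h K),
      (IsFlagLocusComponent w U Z ∧ F ∈ Z) ↔ Z = closure (flagOrbit U F)) ∧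
    (∃ N : Set (Flag m h K), IsOpen N ∧ F ∈ N ∧
      N ∩ flagLocus w h U K ⊆ closure (flagOrbit U F)) ∧
    -- the cocharacter, and the weight space decomposition of its adjoint action
    (∃ β : Cocharacter K m,
      β.ActsBy (hodgePiece w F.fil Fc) (fun p => if Even w then p - w / 2 else p) ∧
      (∀ i : ℤ, (endGraded (hodgePiece w F.fil Fc) i : Set (Matrix (Fin m) (Fin m) K)) =
        β.adWeightSet (-i)) ∧
      (Even w → β.FactorsThrough U) ∧
      β.Normalizes U) ∧
    (iSupIndep (endGraded (hodgePiece w F.fil Fc)) ∧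
      ⨆ i, endGraded (hodgePiece w F.fil Fc) i = ⊤) ∧
    (Odd w → ∃ γ : Cocharacter K m,
      γ.ActsBy (hodgePiece w F.fil Fc) (fun p => 2 * p - w) ∧ γ.FactorsThrough U) ∧
    -- the induced grading of the Lie algebra
    (iSupIndep (fun i : ℤ => lieAlgebra U ⊓ endGraded (hodgePiece w F.fil Fc) i) ∧
      ⨆ i : ℤ, lieAlgebra U ⊓ endGraded (hodgePiece w F.fil Fc) i = lieAlgebra U) ∧
    -- the tangent space
    Set.BijOn (tangentMap F)
      ((⨆ i : ℤ, ⨆ _ : 0 < i, lieAlgebra U ⊓ endGraded (hodgePiece w F.fil Fc) i :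
        Submodule K (Matrix (Fin m) (Fin m) K)) : Set (Matrix (Fin m) (Fin m) K))
      (flagLocusTangent w U F) := by
  obtain ⟨B, d, hF, hFc'⟩ := exists_adapted F.antitone_fil F.exhaustive F.separated hFc hopp
  have hH : ∀ p x, x ∈ hodgePiece w F.fil Fc p ↔ ∀ k, d k ≠ p → (B⁻¹).1.mulVec x k = 0 :=
    fun p x => mem_hodgePiece_iff hF hFc'
  have hpure : IsPure w B d U := by
    intro u hu ab i j hij
    have h1 := hU u hu ab
    rw [show F.fil = adaptedFil B d from funext hF,
      show Fc = adaptedFil B fun k => w - d k from funext hFc'] at h1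
    exact weight_eq_of_mem_midTensors h1.1 h1.2 i j hij
  have hFU : F ∈ flagLocus w h U K := fun u hu ab => (hU u hu ab).1
  have hind := iSupIndep_endGraded hH
  refine ⟨isFlagLocusComponent_iff hF hFc' hpure hopp hFU,
    ⟨_, isOpen_opposed hopp, hopp,
      (opposed_inter_flagLocus_subset hF hFc' hpure).trans subset_closure⟩,
    ?_, ⟨hind, iSup_endGraded hH⟩, fun _ => ?_,
    ⟨hind.mono fun i => inf_le_right, iSup_lieAlgebra_inf_endGraded hpure hH⟩,
    bijOn_tangentMap hF hpure hH⟩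
  · by_cases hw : Even w
    -- For even `w` the division is exact, so `(r, s) = (1, -w/2)` satisfies the condition for
    -- factoring through `G`.
    · have hw' : 2 * -(w / 2) = -1 * w := by
        have := Int.two_mul_ediv_two_of_even hw
        omega
      refine ⟨adaptedCocharacter B fun k => 1 * d k + -(w / 2), ?_, ?_, fun _ =>
        adaptedCocharacter_factorsThrough hpure hw', adaptedCocharacter_normalizes hpure _ _⟩
      · simp only [if_pos hw, one_mul, ← sub_eq_add_neg]
        exact adaptedCocharacter_actsBy hH fun p => p - w / 2
      · simp only [one_mul]
        exact endGraded_eq_adWeightSet hH _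
    · refine ⟨adaptedCocharacter B fun k => 1 * d k + 0, ?_, ?_, fun h => absurd h hw,
        adaptedCocharacter_normalizes hpure _ _⟩
      · simp only [if_neg hw, one_mul, add_zero]
        exact adaptedCocharacter_actsBy hH fun p => p
      · simp only [one_mul]
        exact endGraded_eq_adWeightSet hH _
  · refine ⟨adaptedCocharacter B fun k => 2 * d k + -w, ?_,
      adaptedCocharacter_factorsThrough hpure (by ring)⟩
    simp only [← sub_eq_add_neg]
    exact adaptedCocharacter_actsBy hH fun p => 2 * p - w
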